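/- Let $n$ be a natural number and let $\mathbb{R}^{2n}$ have coordinates $(p,q)$, the standard Euclidean inner product, and the standard complex structure $J(p,q)=(-q,p)$. Let $K\subset\mathbb{R}^{2n}$ be a convex body (a compact convex set with nonempty interior) that is strictly convex (its boundary contains no nondegenerate segment) and has $C^\infty$ boundary. For $z\in\partial K$ let $\nu(z)$ be an outer normal vector of $K$ at $z$ (unique up to a positive factor). A *characteristic* of $K$ is a regular $C^1$ curve $\gamma:\mathbb{R}\to\partial K$ such that for every $t$ the velocity $\dot\gamma(t)\neq 0$ is a real multiple of $J\nu(\gamma(t))$. An *outer billiard trajectory* of $K$ is a sequence $u_0,u_1,u_2,\dots$ of points of $\mathbb{R}^{2n}\setminus K$ such that for every $k$ the midpoint $m_k=\tfrac12(u_k+u_{k+1})$ lies on $\partial K$ and $u_{k+1}-u_k$ is a positive multiple of $J\nu(m_k)$. A curve or a sequence of points is *planar* if it is contained in some $2$-dimensional affine plane. Then all outer billiard trajectories of $K$ are planar if and only if all characteristics of $K$ are planar. -/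

import Mathlib

namespace OuterBilliard

open scoped ContDiff

/-- The symplectic space `ℝ²ⁿ` with its Euclidean structure and coordinates `(p, q)`:
`p i` is the coordinate `Sum.inl i` and `q i` is the coordinate `Sum.inr i`. -/
abbrev Space (n : ℕ) : Type := EuclideanSpace ℝ (Fin n ⊕ Fin n)

/-- The standard complex structure `J (p, q) = (-q, p)`, that is, multiplication by `i` under
`(p, q) ↦ p + i q`. -/
def J (n : ℕ) : Space n →ₗ[ℝ] Space n where
  toFun v := WithLp.toLp 2 (Sum.elim (fun i => -v (Sum.inr i)) (fun i => v (Sum.inl i)))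
  map_add' u v := by
    ext i
    rcases i with i | i
    · simp [add_comm]
    · simp
  map_smul' c v := by
    ext i
    rcases i with i | i <;> simp

/-- `K` has `C^∞` boundary: near every boundary point, `K` is a sublevel set of a smooth function
with nonvanishing differential at that point. -/
def HasSmoothBoundary {n : ℕ} (K : Set (Space n)) : Prop :=
  ∀ z ∈ frontier K, ∃ U : Set (Space n), IsOpen U ∧ z ∈ U ∧ ∃ f : Space n → ℝ,
    ContDiffOn ℝ ∞ f U ∧ fderiv ℝ f z ≠ 0 ∧ K ∩ U = {x ∈ U | f x ≤ 0}

/-- `ν` is a (nonzero, not necessarily unit) outer normal vector of the convex set `K` at `z`. -/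
def IsOuterNormal {n : ℕ} (K : Set (Space n)) (z ν : Space n) : Prop :=
  ν ≠ 0 ∧ ∀ x ∈ K, inner ℝ ν (x - z) ≤ 0

/-- The space `N_z K` spanned by the normals of `K` at `z`; it is a line if `z` is a boundary point
of a convex body with smooth boundary. -/
def normalLine {n : ℕ} (K : Set (Space n)) (z : Space n) : Submodule ℝ (Space n) :=
  Submodule.span ℝ {ν | IsOuterNormal K z ν}

/-- The characteristic line `J N_z K` at `z`. -/
def characteristicLine {n : ℕ} (K : Set (Space n)) (z : Space n) : Submodule ℝ (Space n) :=
  (normalLine K z).map (J n)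

/-- `γ` is a (regularly parametrized) characteristic of `K`: a curve on the boundary of `K` whose
tangent vectors lie in the characteristic lines. -/
def IsCharacteristic {n : ℕ} (K : Set (Space n)) (γ : ℝ → Space n) : Prop :=
  ContDiff ℝ 1 γ ∧
    ∀ t, γ t ∈ frontier K ∧ deriv γ t ≠ 0 ∧ deriv γ t ∈ characteristicLine K (γ t)

/-- The outer billiard map of `K` sends `x` to `y`: the point `x` lies outside `K`, the midpoint of
`x` and `y` lies on the boundary of `K`, and `y - x` has the positively oriented characteristic
direction there. The length of the outer normal `ν` is free, so that `J ν` runs over all positive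
multiples of this direction. -/
def OuterBilliardStep {n : ℕ} (K : Set (Space n)) (x y : Space n) : Prop :=
  x ∉ K ∧ midpoint ℝ x y ∈ frontier K ∧
    ∃ ν, IsOuterNormal K (midpoint ℝ x y) ν ∧ y - x = J n ν

/-- `u 0, u 1, u 2, …` is an outer billiard trajectory of `K`. -/
def IsOuterBilliardTrajectory {n : ℕ} (K : Set (Space n)) (u : ℕ → Space n) : Prop :=
  ∀ k, OuterBilliardStep K (u k) (u (k + 1))

/-- The set `S` lies in some `2`-dimensional affine plane. -/
def IsPlanar {n : ℕ} (S : Set (Space n)) : Prop :=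
  ∃ L : AffineSubspace ℝ (Space n), Module.finrank ℝ L.direction = 2 ∧ S ⊆ (L : Set (Space n))

end OuterBilliard

/-! Let `j` be the rotation and `normal K z` the outer unit normal at `z`. A billiard step from `x`
is determined by a boundary point `z` such that `z - x` is a positive multiple of `j (normal K z)`.
Such a point solves the variational inequality of the skew map `z ↦ j (z - x)` on `K`, hence exists
(`exists_tangent_point`); skewness and strict convexity make it unique (`tangent_point_unique`). An
inner rolling ball makes the normal Lipschitz (`exists_lipschitzOnWith_normal`), so unit-speed
characteristics exist for all time and are unique.

Suppose that trajectories are planar. Then any three consecutive tangent directions are dependent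
(`HasPlanarChains`). Two consecutive steps around a point of a characteristic, shrunk to zero, turn
this into dependence of the first three derivatives (`tangent_expansion`,
`not_linearIndependent_deriv`), provided that the normal curvature in the characteristic direction
is nonzero. Every characteristic has such a point (`exists_curved_time`), hence a planar arc
(`exists_planar_arc`). The plane of the arc meets the interior of `K`, and its section is a smooth
strictly convex planar body whose boundary contains the arc. Call a boundary point of the section
good if the characteristic direction of `K` lies in the plane. Two good tangents followed by a third
dependent on them keep the chain in the plane, so goodness spreads past the end of an arc
(`exists_tangent_extension`) and thus around the whole section (`isTangentPoint_of_arc`). The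
boundary of the section is then itself a characteristic, and uniqueness identifies it with the given
one.

Conversely, a planar characteristic is a characteristic of its plane section, so it sweeps out the
whole boundary of the section (`exists_ge_eq_of_mem_frontier`) and all points there are good. The
billiard of the section is then the restriction of the billiard of `K`, and uniqueness of the step
keeps a trajectory in the plane once it touches there (`tangent_point_mem_plane`). -/

open Set Filter Topology Metric
open scoped NNReal ContDiff

/-! ### Convex projections and the skew variational inequality -/

namespace OuterBilliard

variable {E : Type*} [NormedAddCommGroup E] [InnerProductSpace ℝ E]

/-- `P` is the nearest-point projection onto the convex set `K`. -/
structure IsProjection (K : Set E) (P : E → E) : Prop where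
  mem : ∀ x, P x ∈ K
  inner_le : ∀ x, ∀ y ∈ K, inner ℝ (x - P x) (y - P x) ≤ 0

lemma exists_isProjection [CompleteSpace E] {K : Set E} (hne : K.Nonempty) (hcl : IsClosed K)
    (hK : Convex ℝ K) : ∃ P, IsProjection K P := by
  have h : ∀ x, ∃ p ∈ K, ∀ y ∈ K, inner ℝ (x - p) (y - p) ≤ 0 := fun x => by
    obtain ⟨p, hp, hx⟩ := exists_norm_eq_iInf_of_complete_convex hne hcl.isComplete hK x
    exact ⟨p, hp, (norm_eq_iInf_iff_real_inner_le_zero hK hp).1 hx⟩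
  choose P hP hP' using h
  exact ⟨P, hP, hP'⟩

lemma IsProjection.norm_sub_le {K : Set E} {P : E → E} (hP : IsProjection K P) (x y : E) :
    ‖P x - P y‖ ≤ ‖x - y‖ := by
  have h1 := hP.inner_le x _ (hP.mem y)
  have h2 := hP.inner_le y _ (hP.mem x)
  have h3 : ‖P x - P y‖ * ‖P x - P y‖ ≤ inner ℝ (x - y) (P x - P y) := by
    rw [← real_inner_self_eq_norm_mul_norm]
    simp only [inner_sub_left, inner_sub_right] at *
    linarith [real_inner_comm (P x) (P y)]
  have h4 := real_inner_le_norm (x - y) (P x - P y)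
  by_contra! h
  nlinarith [norm_nonneg (P x - P y), norm_nonneg (x - y)]

lemma IsProjection.lipschitzWith {K : Set E} {P : E → E} (hP : IsProjection K P) :
    LipschitzWith 1 P :=
  LipschitzWith.of_dist_le_mul fun x y => by
    simpa [dist_eq_norm] using hP.norm_sub_le x y

lemma IsProjection.eq_of_inner_le {K : Set E} {P : E → E} (hP : IsProjection K P) {x p : E}
    (hp : p ∈ K) (h : ∀ y ∈ K, inner ℝ (x - p) (y - p) ≤ 0) : P x = p := by
  have h1 := hP.inner_le x _ hp
  have h2 := h _ (hP.mem x)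
  rw [← sub_eq_zero, ← inner_self_eq_zero (𝕜 := ℝ)]
  refine le_antisymm ?_ real_inner_self_nonneg
  simp only [inner_sub_left, inner_sub_right] at *
  linarith [real_inner_comm (P x) p, real_inner_comm (P x) x, real_inner_comm p x]

section Rotation

variable {j : E →ₗᵢ[ℝ] E}

lemma inner_map_left (hj : ∀ x, j (j x) = -x) (x y : E) :
    inner ℝ (j x) y = -inner ℝ x (j y) := by
  rw [← j.inner_map_map x (j y), hj, inner_neg_right, neg_neg]

lemma inner_map_self (hj : ∀ x, j (j x) = -x) (x : E) : inner ℝ (j x) x = 0 := by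
  have := inner_map_left hj x x
  rw [real_inner_comm] at this
  rw [real_inner_comm]
  linarith

lemma inner_self_map (hj : ∀ x, j (j x) = -x) (x : E) : inner ℝ x (j x) = 0 := by
  rw [real_inner_comm, inner_map_self hj]

/-- A skew isometry plus a positive multiple of the identity is strongly monotone, so its
variational inequality on a closed convex set is solved by a contraction. -/
lemma exists_regularized_inequality [CompleteSpace E] (hj : ∀ x, j (j x) = -x) {K : Set E}
    (hne : K.Nonempty) (hcl : IsClosed K) (hK : Convex ℝ K) (x : E) {ε : ℝ} (hε : 0 < ε) :
    ∃ z ∈ K, ∀ y ∈ K, 0 ≤ inner ℝ (j (z - x) + ε • z) (y - z) := by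
  obtain ⟨P, hP⟩ := exists_isProjection hne hcl hK
  -- Before projecting, a step of size `s` scales squared distances by `(1 - s ε)² + s²`. This
  -- choice minimizes that factor, with value `1 / (1 + ε²) < 1`.
  set s : ℝ := ε / (1 + ε ^ 2) with hs
  have hs0 : 0 < s := by positivity
  set Φ : E → E := fun z => P (z - s • (j (z - x) + ε • z)) with hΦ
  set c : ℝ≥0 := Real.toNNReal (Real.sqrt (1 / (1 + ε ^ 2)))
  have hc : (c : ℝ) = Real.sqrt (1 / (1 + ε ^ 2)) := Real.coe_toNNReal _ (Real.sqrt_nonneg _)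
  have hΦc : ContractingWith c Φ := by
    refine ⟨?_, LipschitzWith.of_dist_le_mul fun z w => ?_⟩
    · rw [← NNReal.coe_lt_coe, hc, NNReal.coe_one, Real.sqrt_lt' one_pos, div_lt_iff₀ (by positivity)]
      nlinarith [sq_pos_of_pos hε]
    · rw [dist_eq_norm, dist_eq_norm]
      refine (hP.norm_sub_le _ _).trans (abs_le_of_sq_le_sq' ?_ (by positivity)).2
      have e : z - s • (j (z - x) + ε • z) - (w - s • (j (w - x) + ε • w))
          = (1 - s * ε) • (z - w) - s • j (z - w) := by
        simp only [map_sub]; module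
      rw [e, @norm_sub_sq_real, inner_smul_left, inner_smul_right, inner_self_map hj, norm_smul,
        norm_smul, j.norm_map, mul_pow, mul_pow, mul_pow, hc,
        Real.sq_sqrt (by positivity), Real.norm_eq_abs, Real.norm_eq_abs, sq_abs, sq_abs]
      have : (1 - s * ε) ^ 2 + s ^ 2 = 1 / (1 + ε ^ 2) := by
        rw [hs]; field_simp; ring
      rw [← this]
      apply le_of_eq; simp; ring
  obtain ⟨z, hz⟩ : ∃ z, Φ z = z := ⟨_, hΦc.fixedPoint_isFixedPt⟩
  refine ⟨z, hz ▸ hP.mem _, fun y hy => ?_⟩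
  have h := hP.inner_le (z - s • (j (z - x) + ε • z)) y hy
  change inner ℝ (_ - Φ z) (y - Φ z) ≤ 0 at h
  rw [hz, sub_sub_cancel_left, inner_neg_left, inner_smul_left] at h
  simp only [conj_trivial] at h
  by_contra! hlt
  nlinarith

/-- The variational inequality of a skew isometry on a compact convex set is solvable. -/
lemma exists_skew_inequality [CompleteSpace E] (hj : ∀ x, j (j x) = -x) {K : Set E}
    (hne : K.Nonempty) (hc : IsCompact K) (hK : Convex ℝ K) (x : E) :
    ∃ z ∈ K, ∀ y ∈ K, 0 ≤ inner ℝ (j (z - x)) (y - z) := by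
  -- Without regularization the map is only nonexpansive, so the solution is found as a limit for `ε
  -- → 0`; compactness of `K` supplies it.
  choose z hz hzy using fun k : ℕ => exists_regularized_inequality hj hne hc.isClosed hK x
    (ε := 1 / ((k : ℝ) + 1)) (by positivity)
  obtain ⟨p, hp, φ, hφ, hlim⟩ := hc.tendsto_subseq hz
  refine ⟨p, hp, fun y hy => ?_⟩
  have he : Tendsto (fun k => (1 : ℝ) / ((φ k : ℝ) + 1)) atTop (𝓝 0) :=
    tendsto_one_div_add_atTop_nhds_zero_nat.comp hφ.tendsto_atTop
  have hj' : Tendsto (fun k => j (z (φ k) - x)) atTop (𝓝 (j (p - x))) :=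
    (j.continuous.tendsto _).comp (hlim.sub_const x)
  have : Tendsto (fun k => inner ℝ (j (z (φ k) - x) + ((1 : ℝ) / ((φ k : ℝ) + 1)) • z (φ k))
      (y - z (φ k))) atTop (𝓝 (inner ℝ (j (p - x) + (0 : ℝ) • p) (y - p))) :=
    (hj'.add (he.smul hlim)).inner (tendsto_const_nhds.sub hlim)
  rw [zero_smul, add_zero] at this
  exact ge_of_tendsto' this fun k => hzy (φ k) y hy

end Rotation

/-! ### Smooth strictly convex bodies and their supporting hyperplanes -/

/-- `ν` is the outer unit normal of `K` at `z`. -/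
def IsUnitNormal (K : Set E) (z ν : E) : Prop :=
  ‖ν‖ = 1 ∧ ∀ x ∈ K, inner ℝ ν (x - z) ≤ 0

/-- A strictly convex body with smooth boundary. -/
structure IsSmoothBody (K : Set E) : Prop where
  compact : IsCompact K
  strict : StrictConvex ℝ K
  nonempty_interior : (interior K).Nonempty
  smooth : ∀ z ∈ frontier K, ∃ U : Set E, IsOpen U ∧ z ∈ U ∧ ∃ f : E → ℝ,
    ContDiffOn ℝ ∞ f U ∧ fderiv ℝ f z ≠ 0 ∧ K ∩ U = {x ∈ U | f x ≤ 0}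

namespace IsSmoothBody

variable {K : Set E}

lemma frontier_subset (hK : IsSmoothBody K) : frontier K ⊆ K := hK.compact.isClosed.frontier_subset

lemma isCompact_frontier (hK : IsSmoothBody K) : IsCompact (frontier K) :=
  hK.compact.of_isClosed_subset isClosed_frontier hK.frontier_subset

end IsSmoothBody

/-- A point of a set at which a nonzero functional attains its maximum is a boundary point. -/
lemma mem_frontier_of_inner_le {K : Set E} {z ν : E} (hz : z ∈ K) (hν : ν ≠ 0)
    (h : ∀ x ∈ K, inner ℝ ν (x - z) ≤ 0) : z ∈ frontier K := by
  refine ⟨subset_closure hz, fun hint => ?_⟩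
  have hc : Tendsto (fun t : ℝ => z + t • ν) (𝓝[>] 0) (𝓝 z) := by
    have : Continuous (fun t : ℝ => z + t • ν) := by fun_prop
    simpa using (this.tendsto 0).mono_left nhdsWithin_le_nhds
  obtain ⟨t, ht, ht0⟩ := ((hc.eventually (isOpen_interior.mem_nhds hint)).and
    self_mem_nhdsWithin).exists
  have := h _ (interior_subset ht)
  rw [add_sub_cancel_left, inner_smul_right] at this
  have hp : 0 < inner ℝ ν ν := real_inner_self_pos.2 hν
  have : 0 < t * inner ℝ ν ν := mul_pos ht0 hp
  linarith

/-- A functional attains its maximum on a strictly convex set at one point at most. -/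
lemma eq_of_inner_eq_zero {K : Set E} (hK : StrictConvex ℝ K) {z x ν : E} (hν : ν ≠ 0)
    (hz : z ∈ K) (hx : x ∈ K) (h : ∀ x ∈ K, inner ℝ ν (x - z) ≤ 0)
    (h0 : inner ℝ ν (x - z) = 0) : x = z := by
  by_contra hne
  have hm := hK hx hz hne (a := 1 / 2) (b := 1 / 2) (by norm_num) (by norm_num) (by norm_num)
  set p := (1 / 2 : ℝ) • x + (1 / 2 : ℝ) • z with hp
  have hpz : inner ℝ ν (p - z) = 0 := by
    have : p - z = (1 / 2 : ℝ) • (x - z) := by rw [hp]; module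
    rw [this, inner_smul_right, h0, mul_zero]
  have : p ∈ frontier K := by
    refine mem_frontier_of_inner_le (interior_subset hm) hν fun y hy => ?_
    have h1 := h y hy
    have : y - p = (y - z) - (p - z) := by abel
    rw [this, inner_sub_right, hpz, sub_zero]
    exact h1
  exact this.2 hm

end OuterBilliard

/-! ### The outer normal, the rolling ball and Lipschitz dependence of the normal -/

namespace OuterBilliard

variable {E : Type*} [NormedAddCommGroup E] [InnerProductSpace ℝ E]

/-- The outer unit normal of `K` at `z`. -/
noncomputable def normal (K : Set E) (z : E) : E := Classical.epsilon (IsUnitNormal K z)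

namespace IsSmoothBody

variable {K : Set E}

/-- If `f` were negative at `z`, it would be so nearby, and `z` would be interior to `K`. -/
lemma eq_zero_of_mem_frontier {U : Set E} {f : E → ℝ} {z : E} (hK : IsSmoothBody K)
    (hz : z ∈ frontier K) (hU : IsOpen U) (hzU : z ∈ U) (hf : ContinuousAt f z)
    (hKU : K ∩ U = {x ∈ U | f x ≤ 0}) : f z = 0 := by
  have h1 : z ∈ {x ∈ U | f x ≤ 0} := hKU ▸ ⟨hK.frontier_subset hz, hzU⟩
  refine le_antisymm h1.2 (not_lt.1 fun hlt => hz.2 ?_)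
  rw [mem_interior_iff_mem_nhds]
  filter_upwards [hf.eventually (gt_mem_nhds hlt), hU.mem_nhds hzU] with x hx hxU
  have : x ∈ K ∩ U := by rw [hKU]; exact ⟨hxU, le_of_lt hx⟩
  exact this.1

lemma closedBall_sub_smul_subset {z ν : E} (hν : ‖ν‖ = 1) {r s : ℝ} (hrs : r ≤ s) :
    closedBall (z - r • ν) r ⊆ closedBall (z - s • ν) s := by
  intro x hx
  rw [mem_closedBall, dist_eq_norm] at *
  have : x - (z - s • ν) = (x - (z - r • ν)) + (s - r) • ν := by module
  rw [this]
  refine (norm_add_le _ _).trans ?_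
  rw [norm_smul, hν, mul_one, Real.norm_of_nonneg (by linarith)]
  linarith

variable [FiniteDimensional ℝ E]

/-- At a boundary point the differential of a defining function is a positive multiple of the
outer normal, and this determines the outer normal. -/
lemma isUnitNormal_iff {U : Set E} {f : E → ℝ} {z : E} (hK : IsSmoothBody K)
    (hz : z ∈ frontier K) (hU : IsOpen U) (hzU : z ∈ U) (hf : DifferentiableAt ℝ f z)
    (hf0 : fderiv ℝ f z ≠ 0) (hKU : K ∩ U = {x ∈ U | f x ≤ 0}) (ν : E) :
    IsUnitNormal K z ν ↔ ν = ‖gradient f z‖⁻¹ • gradient f z := by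
  set g := gradient f z with hg
  have hgy : ∀ y, fderiv ℝ f z y = inner ℝ g y := fun y => by
    simp [hg, gradient]
  have hg0 : g ≠ 0 := fun h => hf0 (by ext y; simp [hgy, h])
  have hfz : f z = 0 := hK.eq_zero_of_mem_frontier hz hU hzU hf.continuousAt hKU
  have hline : ∀ y, HasDerivAt (fun s : ℝ => f (z + s • y)) (inner ℝ g y) 0 := fun y => by
    have h1 : HasDerivAt (fun s : ℝ => z + s • y) y 0 := by
      simpa using ((hasDerivAt_id (0 : ℝ)).smul_const y).const_add z
    have h2 : HasFDerivAt f (fderiv ℝ f z) (z + (0 : ℝ) • y) := by simpa using hf.hasFDerivAt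
    have h3 := h2.comp_hasDerivAt (0 : ℝ) h1
    rw [hgy] at h3
    exact h3
  have hnear : ∀ y, ∀ᶠ s : ℝ in 𝓝[>] 0, z + s • y ∈ U := fun y => by
    have : Continuous (fun s : ℝ => z + s • y) := by fun_prop
    have h : Tendsto (fun s : ℝ => z + s • y) (𝓝[>] 0) (𝓝 z) := by
      simpa using (this.tendsto 0).mono_left nhdsWithin_le_nhds
    exact h.eventually (hU.mem_nhds hzU)
  have hnormal : ∀ x ∈ K, inner ℝ g (x - z) ≤ 0 := fun x hx => by
    have ht := (hasDerivAt_iff_tendsto_slope_zero.1 (hline (x - z))).mono_left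
      (nhdsWithin_mono 0 (fun s (hs : (0 : ℝ) < s) => ne_of_gt hs) : 𝓝[>] (0 : ℝ) ≤ 𝓝[≠] 0)
    refine le_of_tendsto ht ?_
    have h1 : ∀ᶠ s : ℝ in 𝓝[>] 0, s < 1 := nhdsWithin_le_nhds (gt_mem_nhds one_pos)
    filter_upwards [hnear (x - z), h1, self_mem_nhdsWithin] with s hsU hs1 hs0
    have hs0 : 0 < s := hs0
    have hmem : z + s • (x - z) ∈ K ∩ U :=
      ⟨hK.strict.convex.add_smul_sub_mem (hK.frontier_subset hz) hx ⟨hs0.le, hs1.le⟩, hsU⟩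
    rw [hKU] at hmem
    simp only [zero_add, zero_smul, add_zero, hfz, sub_zero, smul_eq_mul]
    exact mul_nonpos_of_nonneg_of_nonpos (by positivity) hmem.2
  -- Directions along which `f` decreases to first order point into `K`, so any outer normal is
  -- nonpositive on them.
  have hdir : ∀ μ : E, (∀ x ∈ K, inner ℝ μ (x - z) ≤ 0) → ∀ y, inner ℝ g y < 0 →
      inner ℝ μ y ≤ 0 := fun μ hμ y hy => by
    have ht := (hasDerivAt_iff_tendsto_slope_zero.1 (hline y)).mono_left
      (nhdsWithin_mono 0 (fun s (hs : (0 : ℝ) < s) => ne_of_gt hs) : 𝓝[>] (0 : ℝ) ≤ 𝓝[≠] 0)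
    obtain ⟨s, ⟨hs, hsU⟩, hs0⟩ := ((ht.eventually (gt_mem_nhds hy)).and (hnear y)).and
      self_mem_nhdsWithin |>.exists
    have hs0 : 0 < s := hs0
    simp only [zero_add, zero_smul, add_zero, hfz, sub_zero, smul_eq_mul] at hs
    have hneg : f (z + s • y) < 0 := by
      by_contra! h
      have : 0 ≤ s⁻¹ * f (z + s • y) := by positivity
      linarith
    have hmem : z + s • y ∈ K ∩ U := by rw [hKU]; exact ⟨hsU, hneg.le⟩
    have := hμ _ hmem.1
    rw [add_sub_cancel_left, inner_smul_right] at this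
    by_contra! h
    nlinarith
  have hgn : 0 < ‖g‖ := norm_pos_iff.2 hg0
  constructor
  · rintro ⟨hν1, hν⟩
    have hgg : inner ℝ g (-g) < 0 := by
      rw [inner_neg_right, neg_lt_zero]; exact real_inner_self_pos.2 hg0
    -- A tangent vector is a limit of the decreasing directions `y - ε g`. Applied to the component
    -- of `ν` orthogonal to `g`, this shows that the component vanishes.
    have hker : ∀ y, inner ℝ g y = 0 → inner ℝ ν y ≤ 0 := fun y hy => by
      have hlim : Tendsto (fun ε : ℝ => inner ℝ ν (y + ε • (-g))) (𝓝[>] 0)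
          (𝓝 (inner ℝ ν y)) := by
        have : Continuous (fun ε : ℝ => inner ℝ ν (y + ε • (-g))) := by fun_prop
        simpa using (this.tendsto 0).mono_left nhdsWithin_le_nhds
      refine le_of_tendsto hlim ?_
      filter_upwards [self_mem_nhdsWithin] with ε hε
      refine hdir ν hν _ ?_
      rw [inner_add_right, hy, zero_add, inner_smul_right]
      exact mul_neg_of_pos_of_neg hε hgg
    set c : ℝ := inner ℝ g ν / ‖g‖ ^ 2 with hc
    have hperp : inner ℝ g (ν - c • g) = 0 := by
      rw [inner_sub_right, inner_smul_right, real_inner_self_eq_norm_sq, hc]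
      field_simp; ring
    have h1 := hker _ hperp
    have h2 : inner ℝ (ν - c • g) (ν - c • g) = 0 := by
      refine le_antisymm ?_ real_inner_self_nonneg
      rw [inner_sub_left (𝕜 := ℝ) ν, inner_smul_left, hperp]
      simpa using h1
    have hνc : ν = c • g := by rwa [inner_self_eq_zero, sub_eq_zero] at h2
    have hc0 : 0 ≤ c := by
      have := hdir ν hν _ hgg
      rw [inner_neg_right, real_inner_comm] at this
      rw [hc]; apply div_nonneg _ (by positivity); linarith
    have : c * ‖g‖ = 1 := by rw [← hν1, hνc, norm_smul, Real.norm_of_nonneg hc0]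
    rw [hνc, eq_inv_of_mul_eq_one_left this]
  · rintro rfl
    refine ⟨by rw [norm_smul, norm_inv, norm_norm, inv_mul_cancel₀ hgn.ne'], fun x hx => ?_⟩
    rw [inner_smul_left]
    exact mul_nonpos_of_nonneg_of_nonpos (by simp) (hnormal x hx)

lemma isUnitNormal_normal (hK : IsSmoothBody K) {z : E} (hz : z ∈ frontier K) :
    IsUnitNormal K z (normal K z) := by
  obtain ⟨U, hU, hzU, f, hf, hf0, hKU⟩ := hK.smooth z hz
  exact Classical.epsilon_spec ⟨_, (hK.isUnitNormal_iff hz hU hzU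
    ((hf.contDiffAt (hU.mem_nhds hzU)).differentiableAt (by simp)) hf0 hKU _).2 rfl⟩

lemma eq_normal (hK : IsSmoothBody K) {z ν : E} (hz : z ∈ frontier K) (hν : IsUnitNormal K z ν) :
    ν = normal K z := by
  obtain ⟨U, hU, hzU, f, hf, hf0, hKU⟩ := hK.smooth z hz
  have h := hK.isUnitNormal_iff hz hU hzU
    ((hf.contDiffAt (hU.mem_nhds hzU)).differentiableAt (by simp)) hf0 hKU
  rw [(h _).1 hν, (h _).1 (hK.isUnitNormal_normal hz)]

lemma norm_normal (hK : IsSmoothBody K) {z : E} (hz : z ∈ frontier K) : ‖normal K z‖ = 1 :=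
  (hK.isUnitNormal_normal hz).1

lemma normal_ne_zero (hK : IsSmoothBody K) {z : E} (hz : z ∈ frontier K) : normal K z ≠ 0 :=
  norm_ne_zero_iff.1 (by simp [hK.norm_normal hz])

lemma inner_normal_le (hK : IsSmoothBody K) {z x : E} (hz : z ∈ frontier K) (hx : x ∈ K) :
    inner ℝ (normal K z) (x - z) ≤ 0 :=
  (hK.isUnitNormal_normal hz).2 x hx

lemma inner_normal_lt (hK : IsSmoothBody K) {z x : E} (hz : z ∈ frontier K) (hx : x ∈ K)
    (hne : x ≠ z) : inner ℝ (normal K z) (x - z) < 0 :=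
  (hK.inner_normal_le hz hx).lt_of_ne fun h =>
    hne (eq_of_inner_eq_zero hK.strict (hK.normal_ne_zero hz) (hK.frontier_subset hz) hx
      (fun _ hy => hK.inner_normal_le hz hy) h)

lemma eq_smul_normal (hK : IsSmoothBody K) {z ν : E} (hz : z ∈ frontier K) (hν : ν ≠ 0)
    (h : ∀ x ∈ K, inner ℝ ν (x - z) ≤ 0) : ν = ‖ν‖ • normal K z := by
  have hn : 0 < ‖ν‖ := norm_pos_iff.2 hν
  have : IsUnitNormal K z (‖ν‖⁻¹ • ν) := by
    refine ⟨by rw [norm_smul, norm_inv, norm_norm, inv_mul_cancel₀ hn.ne'], fun x hx => ?_⟩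
    rw [inner_smul_left]
    exact mul_nonpos_of_nonneg_of_nonpos (by simp) (h x hx)
  rw [← hK.eq_normal hz this, smul_smul, mul_inv_cancel₀ hn.ne', one_smul]

/-- For `y = x - z` with `x` in the ball, `‖y‖² ≤ -2 r ⟪n, y⟫`. The linear part of `f` at `z` is
therefore at most `-c ‖y‖² / (2 r)`, which for small `r` outweighs the Taylor error `M ‖y‖²` coming
from the Lipschitz differential. -/
lemma exists_rolling_ball_nhds (hK : IsSmoothBody K) {z₀ : E} (hz₀ : z₀ ∈ frontier K) :
    ∃ V ∈ 𝓝 z₀, ∃ r > 0, ∀ z ∈ V, z ∈ frontier K →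
      closedBall (z - r • normal K z) r ⊆ K := by
  obtain ⟨U, hU, hzU, f, hf, hf0, hKU⟩ := hK.smooth z₀ hz₀
  have hfat : ∀ x ∈ U, ContDiffAt ℝ ∞ f x := fun x hx => hf.contDiffAt (hU.mem_nhds hx)
  have hf' : ContDiffAt ℝ 1 (fderiv ℝ f) z₀ :=
    (hfat z₀ hzU).fderiv_right (m := 1) (WithTop.coe_le_coe.2 (le_top : (1 + 1 : ℕ∞) ≤ ⊤))
  obtain ⟨M, t, ht, hM⟩ := hf'.exists_lipschitzOnWith
  set c : ℝ := ‖fderiv ℝ f z₀‖ / 2 with hc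
  have hc0 : 0 < c := by have := norm_pos_iff.2 hf0; positivity
  have hcnear : ∀ᶠ x in 𝓝 z₀, c < ‖fderiv ℝ f x‖ :=
    hf'.continuousAt.norm.eventually (lt_mem_nhds (by have := norm_pos_iff.2 hf0; linarith))
  obtain ⟨ρ, hρ, hball⟩ := Metric.mem_nhds_iff.1 (inter_mem (inter_mem ht (hU.mem_nhds hzU)) hcnear)
  -- The first bound keeps the ball inside the neighbourhood where the estimates hold; the second
  -- gives `2 M r ≤ c`, with `M + 1` guarding against `M = 0`.
  set r : ℝ := min (ρ / 8) (c / (2 * (M + 1))) with hr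
  have hr0 : 0 < r := lt_min (by positivity) (by positivity)
  refine ⟨ball z₀ (ρ / 2), ball_mem_nhds _ (by positivity), r, hr0, fun z hz hzK x hx => ?_⟩
  have hzb : z ∈ ball z₀ ρ := ball_subset_ball (by linarith) hz
  have hzU' : z ∈ U := (hball hzb).1.2
  have hgc : c < ‖fderiv ℝ f z‖ := (hball hzb).2
  have hfz0 : fderiv ℝ f z ≠ 0 := norm_pos_iff.1 (hc0.trans hgc)
  have hdz : DifferentiableAt ℝ f z := (hfat z hzU').differentiableAt (by simp)
  have hnz := (hK.isUnitNormal_iff hzK hU hzU' hdz hfz0 hKU _).1 (hK.isUnitNormal_normal hzK)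
  have hfz := hK.eq_zero_of_mem_frontier hzK hU hzU' hdz.continuousAt hKU
  have hgy : ∀ y, fderiv ℝ f z y = ‖fderiv ℝ f z‖ * inner ℝ (normal K z) y := fun y => by
    have h1 : ‖gradient f z‖ = ‖fderiv ℝ f z‖ := by simp [gradient]
    have h2 : fderiv ℝ f z y = inner ℝ (gradient f z) y := by simp [gradient]
    rw [hnz, inner_smul_left, h1, h2]
    have := norm_pos_iff.2 hfz0
    simp [mul_inv_cancel_left₀ this.ne']
  set n := normal K z with hn
  have hn1 : ‖n‖ = 1 := hK.norm_normal hzK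
  set y := x - z with hy
  have hxy : ‖y + r • n‖ ≤ r := by
    rw [mem_closedBall, dist_eq_norm] at hx
    have : y + r • n = x - (z - r • n) := by rw [hy]; module
    rwa [this]
  have hyr : ‖y‖ ≤ 2 * r := by
    have : y = (y + r • n) - r • n := by abel
    rw [this]
    refine (norm_sub_le _ _).trans ?_
    rw [norm_smul, hn1, Real.norm_of_nonneg hr0.le]; linarith
  have hyn : ‖y‖ ^ 2 + 2 * r * inner ℝ n y ≤ 0 := by
    have h1 : ‖y + r • n‖ ^ 2 ≤ r ^ 2 := by gcongr
    rw [norm_add_sq_real, inner_smul_right, norm_smul, hn1, Real.norm_of_nonneg hr0.le,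
      real_inner_comm] at h1
    linarith
  have hrρ : r ≤ ρ / 8 := min_le_left _ _
  have hrc : r ≤ c / (2 * (M + 1)) := min_le_right _ _
  have hseg : ∀ w ∈ closedBall z ‖y‖, w ∈ ball z₀ ρ := fun w hw => by
    rw [mem_closedBall] at hw; rw [mem_ball] at *
    have := dist_triangle w z z₀
    linarith
  have hmv := (convex_closedBall z ‖y‖).norm_image_sub_le_of_norm_hasFDerivWithin_le
    (f := fun w => f w - fderiv ℝ f z w) (f' := fun w => fderiv ℝ f w - fderiv ℝ f z)
    (C := M * ‖y‖) (x := z) (y := x)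
    (fun w hw => by
      have hd := ((hfat w (hball (hseg w hw)).1.2).differentiableAt (by simp)).hasFDerivAt
      exact (hd.sub (fderiv ℝ f z).hasFDerivAt).hasFDerivWithinAt)
    (fun w hw => by
      have h1 := hM.dist_le_mul w (hball (hseg w hw)).1.1 z (hball hzb).1.1
      rw [dist_eq_norm] at h1
      refine h1.trans ?_
      gcongr
      exact hw)
    (mem_closedBall_self (norm_nonneg _)) (by rw [mem_closedBall, dist_eq_norm])
  have hxU : x ∈ U := (hball (hseg x (by rw [mem_closedBall, dist_eq_norm]))).1.2
  have hfx : f x ≤ fderiv ℝ f z y + M * ‖y‖ * ‖y‖ := by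
    have h1 := (abs_le.1 (by simpa [Real.norm_eq_abs] using hmv)).2
    rw [hy, map_sub]
    rw [hfz] at h1
    simp only [hy] at *
    linarith
  have hneg : f x ≤ 0 := by
    rw [hgy] at hfx
    have hin : inner ℝ n y ≤ -(‖y‖ ^ 2 / (2 * r)) := by
      rw [le_neg, div_le_iff₀ (by positivity)]; linarith
    have h3 : M * r * 2 ≤ c := by
      rw [le_div_iff₀ (by positivity)] at hrc
      nlinarith
    have h4 : ‖fderiv ℝ f z‖ * inner ℝ n y ≤ c * -(‖y‖ ^ 2 / (2 * r)) := by
      have : 0 ≤ ‖y‖ ^ 2 / (2 * r) := by positivity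
      nlinarith
    have h5 : M * ‖y‖ * ‖y‖ ≤ c * (‖y‖ ^ 2 / (2 * r)) := by
      rw [← mul_div_assoc, le_div_iff₀ (by positivity)]
      nlinarith [sq_nonneg ‖y‖]
    linarith
  have : x ∈ K ∩ U := by rw [hKU]; exact ⟨hxU, hneg⟩
  exact this.1

/-- **Blaschke's rolling theorem** (qualitative form): a ball of some fixed radius touches the
boundary from inside at every boundary point. -/
lemma exists_rolling_ball (hK : IsSmoothBody K) :
    ∃ r > 0, ∀ z ∈ frontier K, closedBall (z - r • normal K z) r ⊆ K := by
  refine hK.isCompact_frontier.induction_on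
    (p := fun s => ∃ r > 0, ∀ z ∈ s, z ∈ frontier K → closedBall (z - r • normal K z) r ⊆ K)
    ⟨1, one_pos, by simp⟩ ?_ ?_ ?_ |>.imp fun r hr => ⟨hr.1, fun z hz => hr.2 z hz hz⟩
  · rintro s t hst ⟨r, hr, h⟩
    exact ⟨r, hr, fun z hz => h z (hst hz)⟩
  · rintro s t ⟨r, hr, h⟩ ⟨r', hr', h'⟩
    refine ⟨min r r', lt_min hr hr', fun z hz hzK => ?_⟩
    rcases hz with hz | hz
    · exact (closedBall_sub_smul_subset (hK.norm_normal hzK) (min_le_left _ _)).trans (h z hz hzK)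
    · exact (closedBall_sub_smul_subset (hK.norm_normal hzK) (min_le_right _ _)).trans
        (h' z hz hzK)
  · intro z hz
    obtain ⟨V, hV, r, hr, h⟩ := hK.exists_rolling_ball_nhds hz
    exact ⟨V, mem_nhdsWithin_of_mem_nhds hV, r, hr, h⟩

/-- The point of the ball rolling at `z` that is extreme in the direction `normal K x` lies in `K`,
hence below the supporting hyperplane at `x`. -/
lemma sq_norm_normal_sub_le (hK : IsSmoothBody K) {r : ℝ} (hr : 0 < r)
    (hroll : ∀ z ∈ frontier K, closedBall (z - r • normal K z) r ⊆ K) {x z : E}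
    (hx : x ∈ frontier K) (hz : z ∈ frontier K) :
    r / 2 * ‖normal K x - normal K z‖ ^ 2 ≤ inner ℝ (normal K x) (x - z) := by
  have hmem : z - r • normal K z + r • normal K x ∈ K := by
    refine hroll z hz ?_
    rw [mem_closedBall, dist_eq_norm, add_sub_cancel_left, norm_smul, hK.norm_normal hx,
      Real.norm_of_nonneg hr.le, mul_one]
  have h := hK.inner_normal_le hx hmem
  have e : z - r • normal K z + r • normal K x - x
      = r • normal K x - r • normal K z - (x - z) := by abel
  rw [e, inner_sub_right, inner_sub_right, inner_smul_right, inner_smul_right,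
    real_inner_self_eq_norm_sq, hK.norm_normal hx] at h
  rw [norm_sub_sq_real, hK.norm_normal hx, hK.norm_normal hz]
  linarith

/-- Adding `sq_norm_normal_sub_le` for `(x, z)` and `(z, x)` gives `r ‖Δn‖² ≤ ⟪Δn, x - z⟫`, and
Cauchy–Schwarz yields the constant `1 / r`. -/
lemma exists_lipschitzOnWith_normal (hK : IsSmoothBody K) :
    ∃ Λ : ℝ≥0, LipschitzOnWith Λ (normal K) (frontier K) := by
  obtain ⟨r, hr, hroll⟩ := hK.exists_rolling_ball
  refine ⟨Real.toNNReal r⁻¹, LipschitzOnWith.of_dist_le_mul fun x hx z hz => ?_⟩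
  have h1 := hK.sq_norm_normal_sub_le hr hroll hx hz
  have h2 := hK.sq_norm_normal_sub_le hr hroll hz hx
  rw [norm_sub_rev] at h2
  have h3 : inner ℝ (normal K x) (x - z) + inner ℝ (normal K z) (z - x)
      = inner ℝ (normal K x - normal K z) (x - z) := by
    rw [inner_sub_left, ← neg_sub x z, inner_neg_right]; ring
  have h4 := real_inner_le_norm (normal K x - normal K z) (x - z)
  rw [dist_eq_norm, dist_eq_norm, Real.coe_toNNReal _ (by positivity), inv_mul_eq_div,
    le_div_iff₀ hr]
  by_contra! h
  nlinarith [norm_nonneg (normal K x - normal K z), norm_nonneg (x - z)]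

lemma continuousOn_normal (hK : IsSmoothBody K) : ContinuousOn (normal K) (frontier K) :=
  let ⟨_, h⟩ := hK.exists_lipschitzOnWith_normal
  h.continuousOn

end IsSmoothBody

end OuterBilliard

/-! ### Existence, uniqueness and smoothness of the characteristic flow -/

namespace OuterBilliard

variable {E : Type*} [NormedAddCommGroup E] [InnerProductSpace ℝ E]

/-- A bounded Lipschitz vector field is complete. -/
lemma exists_integral_curve [CompleteSpace E] {v : E → E} {C : ℝ≥0} (hv : LipschitzWith C v)
    (hb : ∀ x, ‖v x‖ ≤ 1) (x : E) : ∃ γ : ℝ → E, γ 0 = x ∧ ∀ t, HasDerivAt γ (v (γ t)) t := by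
  have hex : ∀ N : ℕ, ∃ α : ℝ → E, α 0 = x ∧
      ∀ t ∈ Ioo (-((N : ℝ) + 1)) ((N : ℝ) + 1), HasDerivAt α (v (α t)) t := fun N => by
    have h0 : (0 : ℝ) ∈ Icc (-((N : ℝ) + 1)) ((N : ℝ) + 1) :=
      ⟨by linarith [N.cast_nonneg (α := ℝ)], by positivity⟩
    -- Speed at most one confines the solution to the ball of radius `N + 1` up to time `N + 1`.
    have hp : IsPicardLindelof (fun _ => v) (⟨0, h0⟩ : Icc (-((N : ℝ) + 1)) ((N : ℝ) + 1)) x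
        ((N : ℝ≥0) + 1) 0 1 C :=
      { lipschitzOnWith := fun _ _ => hv.lipschitzOnWith
        continuousOn := fun _ _ => continuousOn_const
        norm_le := fun _ _ y _ => by simpa using hb y
        mul_max_le := by simp }
    obtain ⟨α, hα0, hα⟩ := hp.exists_eq_forall_mem_Icc_hasDerivWithinAt₀
    exact ⟨α, hα0, fun t ht =>
      (hα t (Ioo_subset_Icc_self ht)).hasDerivAt (Icc_mem_nhds ht.1 ht.2)⟩
  choose α hα0 hα using hex
  have hagree : ∀ M N : ℕ, M ≤ N → ∀ t : ℝ, |t| < (M : ℝ) + 1 → α M t = α N t := by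
    intro M N hMN t ht
    have hMN' : (M : ℝ) ≤ N := by exact_mod_cast hMN
    refine ODE_solution_unique_of_mem_Ioo (v := fun _ => v) (s := fun _ => univ) (K := C)
      (t₀ := 0) (a := -((M : ℝ) + 1)) (b := (M : ℝ) + 1) (fun _ _ => hv.lipschitzOnWith)
      ⟨by linarith [M.cast_nonneg (α := ℝ)], by positivity⟩ (fun s hs => ⟨hα M s hs, trivial⟩)
      (fun s hs => ⟨hα N s ⟨by linarith [hs.1], by linarith [hs.2]⟩, trivial⟩)
      (by rw [hα0, hα0]) (abs_lt.1 ht)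
  -- The local solutions are glued; near `t` the glued curve agrees with the single solution of
  -- index `⌈|t|⌉₊ + 1`, so it can be differentiated there.
  refine ⟨fun t => α ⌈|t|⌉₊ t, by simp [hα0], fun t => ?_⟩
  have hev : ∀ s : ℝ, |s| < (⌈|t|⌉₊ : ℝ) + 1 → α ⌈|s|⌉₊ s = α (⌈|t|⌉₊ + 1) s := fun s hs => by
    refine hagree _ _ (Nat.ceil_le.2 (by push_cast; exact hs.le)) s ?_
    linarith [Nat.le_ceil |s|]
  have ht : |t| < (⌈|t|⌉₊ : ℝ) + 1 := by linarith [Nat.le_ceil |t|]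
  have hd := hα (⌈|t|⌉₊ + 1) t (abs_lt.1 (by push_cast; linarith))
  rw [← hev t ht] at hd
  refine hd.congr_of_eventuallyEq ?_
  filter_upwards [(continuous_abs.tendsto t).eventually (gt_mem_nhds ht)] with s hs
  exact hev s hs

/-- The radial retraction onto the unit ball. -/
noncomputable def radialRetraction (y : E) : E := (max 1 ‖y‖)⁻¹ • y

lemma isProjection_radialRetraction :
    IsProjection (closedBall (0 : E) 1) (radialRetraction : E → E) := by
  constructor
  · intro y
    rw [mem_closedBall_zero_iff, radialRetraction, norm_smul, norm_inv,
      Real.norm_of_nonneg (by positivity), inv_mul_le_iff₀ (by positivity), mul_one]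
    exact le_max_right _ _
  · intro y w hw
    rw [mem_closedBall_zero_iff] at hw
    rcases le_total ‖y‖ 1 with h | h
    · simp [radialRetraction, max_eq_left h]
    · have hy : 0 < ‖y‖ := by linarith
      have e : y - radialRetraction y = (1 - ‖y‖⁻¹) • y := by
        rw [radialRetraction, max_eq_right h]; module
      rw [e, inner_smul_left, radialRetraction, max_eq_right h, inner_sub_right,
        inner_smul_right, real_inner_self_eq_norm_sq]
      have h1 : inner ℝ y w ≤ ‖y‖ := (real_inner_le_norm y w).trans (by nlinarith)
      have h2 : ‖y‖⁻¹ * ‖y‖ ^ 2 = ‖y‖ := by field_simp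
      have h3 : ‖y‖⁻¹ ≤ 1 := inv_le_one_of_one_le₀ h
      rw [h2]
      exact mul_nonpos_of_nonneg_of_nonpos (by simpa using h3) (by linarith)

/-- The squared distance to a convex set is differentiable. -/
lemma IsProjection.hasFDerivAt_sq_norm {K : Set E} {P : E → E} (hP : IsProjection K P) (x : E) :
    HasFDerivAt (fun y => ‖y - P y‖ ^ 2) ((2 : ℝ) • innerSL ℝ (x - P x)) x := by
  -- Comparing with the foot point of the other point squeezes the increment from both sides, with a
  -- quadratic error.
  have hle : ∀ y z, ‖y - P y‖ ^ 2 ≤ ‖y - P z‖ ^ 2 := fun y z => by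
    have h := hP.inner_le y _ (hP.mem z)
    have e : y - P z = (y - P y) - (P z - P y) := by abel
    rw [e, norm_sub_sq_real (y - P y)]
    nlinarith [sq_nonneg ‖P z - P y‖]
  have hexp : ∀ y z, ‖y - P z‖ ^ 2 = ‖z - P z‖ ^ 2 + 2 * inner ℝ (z - P z) (y - z)
      + ‖y - z‖ ^ 2 := fun y z => by
    have e : y - P z = (z - P z) + (y - z) := by abel
    rw [e, norm_add_sq_real]
  have hbound : ∀ y, ‖‖y - P y‖ ^ 2 - ‖x - P x‖ ^ 2 - ((2 : ℝ) • innerSL ℝ (x - P x)) (y - x)‖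
      ≤ 5 * ‖‖y - x‖ ^ 2‖ := fun y => by
    have h1 := hle y x
    have h2 := hle x y
    rw [hexp y x] at h1
    rw [hexp x y] at h2
    rw [norm_sub_rev x y] at h2
    have h3 : inner ℝ (y - P y) (x - y) + inner ℝ (x - P x) (y - x)
        = inner ℝ ((x - P x) - (y - P y)) (y - x) := by
      rw [inner_sub_left (x - P x), ← neg_sub y x, inner_neg_right]; ring
    have h4 := abs_le.1 (abs_real_inner_le_norm ((x - P x) - (y - P y)) (y - x))
    have h5 : ‖(x - P x) - (y - P y)‖ ≤ 2 * ‖y - x‖ := by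
      have e : (x - P x) - (y - P y) = (P y - P x) - (y - x) := by abel
      rw [e]
      refine (_root_.norm_sub_le _ _).trans ?_
      linarith [hP.norm_sub_le y x]
    have h6 : ‖(x - P x) - (y - P y)‖ * ‖y - x‖ ≤ 2 * ‖y - x‖ ^ 2 := by
      nlinarith [norm_nonneg (y - x)]
    rw [Real.norm_eq_abs, Real.norm_of_nonneg (by positivity : 0 ≤ ‖y - x‖ ^ 2), abs_le]
    simp only [smul_apply, innerSL_apply_apply, smul_eq_mul]
    constructor <;> nlinarith [sq_nonneg ‖y - x‖]
  refine .of_isLittleO ?_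
  refine (Asymptotics.IsBigO.of_bound 5 (Eventually.of_forall hbound)).trans_isLittleO ?_
  exact Asymptotics.isLittleO_pow_sub_sub x one_lt_two

/-- A unit-speed characteristic on the boundary of `K`, with respect to the rotation `j`. -/
structure IsFlowLine (j : E →ₗᵢ[ℝ] E) (K : Set E) (γ : ℝ → E) : Prop where
  mem : ∀ t, γ t ∈ frontier K
  hasDerivAt : ∀ t, HasDerivAt γ (j (normal K (γ t))) t

variable {j : E →ₗᵢ[ℝ] E} {K : Set E}

lemma IsFlowLine.comp_add {γ : ℝ → E} (hγ : IsFlowLine j K γ) (a : ℝ) :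
    IsFlowLine j K (fun t => γ (t + a)) :=
  ⟨fun _ => hγ.mem _, fun t => (hγ.hasDerivAt (t + a)).comp_add_const t a⟩

lemma IsFlowLine.continuous {γ : ℝ → E} (hγ : IsFlowLine j K γ) : Continuous γ :=
  continuous_iff_continuousAt.2 fun t => (hγ.hasDerivAt t).continuousAt

lemma IsFlowLine.deriv {γ : ℝ → E} (hγ : IsFlowLine j K γ) :
    deriv γ = fun t => j (normal K (γ t)) :=
  funext fun t => (hγ.hasDerivAt t).deriv

namespace IsSmoothBody

variable [FiniteDimensional ℝ E]

/-- Through every boundary point passes a complete unit-speed characteristic. -/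
lemma exists_isFlowLine (hK : IsSmoothBody K) (hj : ∀ x, j (j x) = -x) {x : E}
    (hx : x ∈ frontier K) (t₀ : ℝ) : ∃ γ, IsFlowLine j K γ ∧ γ t₀ = x := by
  obtain ⟨r, hr, hroll⟩ := hK.exists_rolling_ball
  -- The inner parallel body. The boundary of `K` is the level set at distance `r` from `K'`, and
  -- the normal is the gradient of this distance, which extends the normal off the boundary.
  set K' : Set E := {c | ∀ w ∈ closedBall (0 : E) r, c + w ∈ K} with hK'
  have hmemK' : ∀ z ∈ frontier K, z - r • normal K z ∈ K' := fun z hz w hw =>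
    hroll z hz (by simpa [mem_closedBall, dist_eq_norm] using hw)
  have hcl : IsClosed K' := by
    simp only [hK', ofPred_forall]
    refine isClosed_iInter fun w => isClosed_iInter fun _ => ?_
    exact hK.compact.isClosed.preimage (by fun_prop : Continuous fun c : E => c + w)
  have hconv : Convex ℝ K' := fun a ha b hb s t hs ht hst w hw => by
    have := hK.strict.convex (ha w hw) (hb w hw) hs ht hst
    have e : s • (a + w) + t • (b + w) = s • a + t • b + (s + t) • w := by module
    rwa [e, hst, one_smul] at this
  obtain ⟨P, hP⟩ := exists_isProjection ⟨_, hmemK' x hx⟩ hcl hconv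
  have hPz : ∀ z ∈ frontier K, P z = z - r • normal K z := fun z hz => by
    refine hP.eq_of_inner_le (hmemK' z hz) fun y hy => ?_
    have h1 : y + r • normal K z ∈ K := hy _ (by
      rw [mem_closedBall_zero_iff, norm_smul, hK.norm_normal hz, Real.norm_of_nonneg hr.le,
        mul_one])
    have h2 := hK.inner_normal_le hz h1
    have e1 : z - (z - r • normal K z) = r • normal K z := by abel
    have e2 : y - (z - r • normal K z) = y + r • normal K z - z := by abel
    rw [e1, e2, inner_smul_left]
    exact mul_nonpos_of_nonneg_of_nonpos (by simpa using hr.le) h2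
  have hback : ∀ z, ‖z - P z‖ = r → z ∈ frontier K ∧ normal K z = r⁻¹ • (z - P z) := fun z hz => by
    set μ := z - P z with hμ
    have hμ0 : μ ≠ 0 := norm_pos_iff.1 (by rw [hz]; exact hr)
    have hzK : z ∈ K := by
      have := hP.mem z μ (by rw [mem_closedBall_zero_iff, hz])
      rwa [hμ, add_sub_cancel] at this
    -- If `y₀` maximizes `μ` on `K`, then `y₀ - μ` lies in `K'`, and the projection inequality at
    -- `z` says that `z` does at least as well as `y₀`.
    have hsup : ∀ y ∈ K, inner ℝ μ (y - z) ≤ 0 := by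
      obtain ⟨y₀, hy₀, hmax⟩ := hK.compact.exists_isMaxOn ⟨z, hzK⟩
        (f := fun y => inner ℝ μ y) (by fun_prop)
      have hle : ∀ y ∈ K, inner ℝ μ (y - y₀) ≤ 0 := fun y hy => by
        rw [inner_sub_right]; linarith [isMaxOn_iff.1 hmax y hy]
      have hfr := mem_frontier_of_inner_le hy₀ hμ0 hle
      have hn := hK.eq_smul_normal hfr hμ0 hle
      rw [hz] at hn
      have h1 := hP.inner_le z _ (hmemK' y₀ hfr)
      rw [← hμ, ← hn] at h1
      have e : y₀ - μ - P z = (y₀ - z) := by rw [hμ]; abel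
      rw [e] at h1
      intro y hy
      have := hle y hy
      rw [inner_sub_right] at *
      linarith
    have hfr := mem_frontier_of_inner_le hzK hμ0 hsup
    refine ⟨hfr, ?_⟩
    rw [hK.eq_smul_normal hfr hμ0 hsup, hz, smul_smul, inv_mul_cancel₀ hr.ne', one_smul]
  -- A bounded Lipschitz field on the whole space. The retraction only caps the length and changes
  -- nothing at distance `r` from `K'`, where the argument is a unit vector.
  set v : E → E := fun y => j (radialRetraction (r⁻¹ • (y - P y))) with hv
  have hvL : LipschitzWith (1 * (1 * (‖r⁻¹‖₊ * (1 + 1)))) v := by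
    refine j.lipschitz.comp (isProjection_radialRetraction.lipschitzWith.comp ?_)
    exact (lipschitzWith_smul r⁻¹).comp (LipschitzWith.id.sub hP.lipschitzWith)
  have hvb : ∀ y, ‖v y‖ ≤ 1 := fun y => by
    rw [hv, j.norm_map]
    exact mem_closedBall_zero_iff.1 (isProjection_radialRetraction.mem _)
  obtain ⟨α, hα0, hα⟩ := exists_integral_curve hvL hvb x
  -- The velocity is a rotated gradient, hence orthogonal to the gradient: the distance to `K'` is
  -- conserved and the curve stays on the boundary.
  have hconst : ∀ t, ‖α t - P (α t)‖ ^ 2 = r ^ 2 := fun t => by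
    have hd : ∀ s, HasDerivAt (fun s => ‖α s - P (α s)‖ ^ 2) 0 s := fun s => by
      have h := (hP.hasFDerivAt_sq_norm (α s)).comp_hasDerivAt s (hα s)
      have : ((2 : ℝ) • innerSL ℝ (α s - P (α s))) (v (α s)) = 0 := by
        simp only [hv, radialRetraction, map_smul, smul_apply,
          innerSL_apply_apply, inner_self_map hj, smul_zero]
      rw [this] at h
      exact h
    have h := is_const_of_deriv_eq_zero (fun s => (hd s).differentiableAt)
      (fun s => (hd s).deriv) t 0
    rw [h, hα0, hPz x hx, sub_sub_cancel, norm_smul, hK.norm_normal hx,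
      Real.norm_of_nonneg hr.le, mul_one]
  have hr' : ∀ t, ‖α t - P (α t)‖ = r := fun t =>
    (sq_eq_sq₀ (norm_nonneg _) hr.le).1 (hconst t)
  have hflow : IsFlowLine j K α := by
    refine ⟨fun t => (hback _ (hr' t)).1, fun t => ?_⟩
    have h := hα t
    have e : v (α t) = j (normal K (α t)) := by
      rw [(hback _ (hr' t)).2, hv]
      simp only [radialRetraction]
      rw [norm_smul, hr' t, Real.norm_of_nonneg (by positivity), inv_mul_cancel₀ hr.ne', max_self,
        inv_one, one_smul]
    rwa [e] at h
  exact ⟨fun t => α (t + -t₀), hflow.comp_add _, by simpa using hα0⟩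

lemma lipschitzOnWith_map_normal (hK : IsSmoothBody K) (j : E →ₗᵢ[ℝ] E) :
    ∃ Λ : ℝ≥0, LipschitzOnWith Λ (fun x => j (normal K x)) (frontier K) := by
  obtain ⟨Λ, h⟩ := hK.exists_lipschitzOnWith_normal
  exact ⟨1 * Λ, j.lipschitz.comp_lipschitzOnWith h⟩

lemma isFlowLine_unique (hK : IsSmoothBody K) {γ δ : ℝ → E} (hγ : IsFlowLine j K γ)
    (hδ : IsFlowLine j K δ) {t₀ : ℝ} (h : γ t₀ = δ t₀) : γ = δ := by
  obtain ⟨Λ, hΛ⟩ := hK.lipschitzOnWith_map_normal j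
  exact ODE_solution_unique_univ (v := fun _ x => j (normal K x)) (s := fun _ => frontier K)
    (fun _ => hΛ) (fun t => ⟨hγ.hasDerivAt t, hγ.mem t⟩) (fun t => ⟨hδ.hasDerivAt t, hδ.mem t⟩) h

/-- Bootstrapping: on the boundary the normal equals the normalized gradient of a local defining
function, so the velocity is a smooth function of the position. -/
lemma contDiff_of_isFlowLine (hK : IsSmoothBody K) {γ : ℝ → E} (hγ : IsFlowLine j K γ) (n : ℕ) :
    ContDiff ℝ n γ := by
  induction n with
  | zero => exact contDiff_zero.2 hγ.continuous
  | succ n ih =>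
    rw [Nat.cast_succ, contDiff_succ_iff_deriv]
    refine ⟨fun t => (hγ.hasDerivAt t).differentiableAt, by simp, ?_⟩
    rw [hγ.deriv, contDiff_iff_contDiffAt]
    intro t
    obtain ⟨U, hU, hzU, f, hf, hf0, hKU⟩ := hK.smooth _ (hγ.mem t)
    have hfat : ∀ x ∈ U, ContDiffAt ℝ ∞ f x := fun x hx => hf.contDiffAt (hU.mem_nhds hx)
    have hf' : ContDiffAt ℝ n (fderiv ℝ f) (γ t) :=
      (hfat _ hzU).fderiv_right (m := n) (WithTop.coe_le_coe.2 (le_top : ((n : ℕ∞) + 1) ≤ ⊤))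
    have hg : ContDiffAt ℝ n (gradient f) (γ t) :=
      ((InnerProductSpace.toDual ℝ E).symm.toContinuousLinearEquiv.contDiff.contDiffAt).comp _ hf'
    have hg0 : gradient f (γ t) ≠ 0 := by simpa [gradient] using hf0
    have hX : ContDiffAt ℝ n (fun x => j (‖gradient f x‖⁻¹ • gradient f x)) (γ t) :=
      (j.contDiff.contDiffAt).comp (γ t)
        (((hg.norm ℝ hg0).inv (norm_ne_zero_iff.2 hg0)).smul hg)
    refine (hX.comp t ih.contDiffAt).congr_of_eventuallyEq ?_
    have hne : ∀ᶠ x in 𝓝 (γ t), fderiv ℝ f x ≠ 0 :=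
      hf'.continuousAt.eventually (isOpen_ne.mem_nhds hf0)
    filter_upwards [hγ.continuous.continuousAt.eventually
      (hne.and (hU.mem_nhds hzU))] with s hs
    simp only [Function.comp_apply]
    rw [(hK.isUnitNormal_iff (hγ.mem s) hU hs.2 ((hfat _ hs.2).differentiableAt (by simp)) hs.1
      hKU _).1 (hK.isUnitNormal_normal (hγ.mem s))]

end IsSmoothBody

end OuterBilliard

/-! ### Tangent points of the billiard and their asymptotics for short steps -/

namespace OuterBilliard

variable {E : Type*} [NormedAddCommGroup E] [InnerProductSpace ℝ E]
variable {j : E →ₗᵢ[ℝ] E} {K : Set E}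

namespace IsSmoothBody

variable [FiniteDimensional ℝ E]

/-- From every point outside `K` there is a step of the outer billiard. -/
lemma exists_tangent_point (hK : IsSmoothBody K) (hj : ∀ x, j (j x) = -x) {x : E} (hx : x ∉ K) :
    ∃ z ∈ frontier K, ∃ s : ℝ, 0 < s ∧ z = x + s • j (normal K z) := by
  obtain ⟨z, hz, h⟩ := exists_skew_inequality hj (hK.nonempty_interior.mono interior_subset)
    hK.compact hK.strict.convex x
  set ν := -j (z - x) with hν
  have hne : z - x ≠ 0 := sub_ne_zero.2 fun e => hx (e ▸ hz)
  have hν0 : ν ≠ 0 := by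
    rw [hν, neg_ne_zero]
    exact fun e => hne (by rwa [map_eq_zero_iff j j.injective] at e)
  have hle : ∀ y ∈ K, inner ℝ ν (y - z) ≤ 0 := fun y hy => by
    rw [hν, inner_neg_left]; linarith [h y hy]
  have hfr := mem_frontier_of_inner_le hz hν0 hle
  refine ⟨z, hfr, ‖ν‖, norm_pos_iff.2 hν0, ?_⟩
  rw [← map_smul, ← hK.eq_smul_normal hfr hν0 hle, hν, map_neg, hj]
  abel

/-- The step of the outer billiard is unique. -/
lemma tangent_point_unique (hK : IsSmoothBody K) (hj : ∀ x, j (j x) = -x) {x z w : E} {s t : ℝ}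
    (hz : z ∈ frontier K) (hw : w ∈ frontier K) (hs : 0 < s) (ht : 0 < t)
    (hzx : z = x + s • j (normal K z)) (hwx : w = x + t • j (normal K w)) : z = w := by
  have e1 : w - z = t • j (normal K w) - s • j (normal K z) := by
    nth_rw 1 [hzx, hwx]; abel
  have e2 : z - w = s • j (normal K z) - t • j (normal K w) := by
    rw [← neg_sub, e1]; abel
  have h1 := hK.inner_normal_le hz (hK.frontier_subset hw)
  have h2 := hK.inner_normal_le hw (hK.frontier_subset hz)
  by_contra hne
  -- Support at `z` makes `⟪n z, j (n w)⟫` negative, while support at `w` and skewness of `j` make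
  -- it nonnegative.
  have h3 := hK.inner_normal_lt hz (hK.frontier_subset hw) (Ne.symm hne)
  rw [e1, inner_sub_right, inner_smul_right, inner_smul_right, inner_self_map hj] at h3
  rw [e2, inner_sub_right, inner_smul_right, inner_smul_right, inner_self_map hj,
    real_inner_comm, inner_map_left hj] at h2
  nlinarith

lemma add_smul_notMem (hK : IsSmoothBody K) (hj : ∀ x, j (j x) = -x) {z : E}
    (hz : z ∈ frontier K) {s : ℝ} (hs : s ≠ 0) : z + s • j (normal K z) ∉ K := fun h => by
  have h1 := eq_of_inner_eq_zero hK.strict (hK.normal_ne_zero hz) (hK.frontier_subset hz) h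
    (fun _ hy => hK.inner_normal_le hz hy) (by
      rw [add_sub_cancel_left, inner_smul_right, inner_self_map hj, mul_zero])
  rw [add_eq_left, smul_eq_zero, map_eq_zero_iff j j.injective] at h1
  exact h1.elim hs (hK.normal_ne_zero hz)

/-- At a cluster point `p` of the tangent points, the tangent hyperplane contains `z`, so strict
convexity forces `p = z`. No control of the step lengths is needed. -/
lemma tendsto_tangent_point (hK : IsSmoothBody K) (hj : ∀ x, j (j x) = -x) {ι : Type*}
    {l : Filter ι} {x m : ι → E} {s : ι → ℝ} {z : E} (hz : z ∈ frontier K)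
    (hx : Tendsto x l (𝓝 z)) (hm : ∀ᶠ i in l, m i ∈ frontier K)
    (hms : ∀ᶠ i in l, m i = x i + s i • j (normal K (m i))) : Tendsto m l (𝓝 z) := by
  refine hK.isCompact_frontier.tendsto_nhds_of_unique_mapClusterPt hm fun p hp hcl => ?_
  obtain ⟨u, hu, hup⟩ := mapClusterPt_iff_ultrafilter.1 hcl
  have hn : Tendsto (fun i => normal K (m i)) u (𝓝 (normal K p)) :=
    (hK.continuousOn_normal p hp).tendsto.comp
      (tendsto_nhdsWithin_iff.2 ⟨hup, hm.filter_mono hu⟩)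
  have hlim : Tendsto (fun i => inner ℝ (normal K (m i)) (x i - m i)) u
      (𝓝 (inner ℝ (normal K p) (z - p))) := hn.inner ((hx.mono_left hu).sub hup)
  have h0 : (fun i => inner ℝ (normal K (m i)) (x i - m i)) =ᶠ[u] fun _ => 0 := by
    filter_upwards [hms.filter_mono hu] with i hi
    have : x i - m i = -(s i • j (normal K (m i))) := by nth_rw 1 [hi]; abel
    rw [this, inner_neg_right, inner_smul_right, inner_self_map hj, mul_zero, neg_zero]
  have h1 := tendsto_nhds_unique hlim (tendsto_const_nhds.congr' h0.symm)
  exact (eq_of_inner_eq_zero hK.strict (hK.normal_ne_zero hp) (hK.frontier_subset hp)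
    (hK.frontier_subset hz) (fun _ hy => hK.inner_normal_le hp hy) h1).symm

end IsSmoothBody

open Asymptotics

lemma taylor_two_isLittleO {f : ℝ → E} (hf : ContDiff ℝ 2 f) :
    (fun t => f t - f 0 - t • deriv f 0 - (t ^ 2 / 2) • deriv (deriv f) 0)
      =o[𝓝 0] fun t => t ^ 2 := by
  have h := taylor_isLittleO_univ (x₀ := 0) (n := 2) hf
  simp only [sub_zero] at h
  refine h.congr_left fun t => ?_
  simp only [taylorWithinEval_succ, taylor_within_zero_eval, iteratedDerivWithin_univ,
    iteratedDeriv_succ, iteratedDeriv_zero]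
  norm_num
  module

lemma IsFlowLine.norm_sub_le [FiniteDimensional ℝ E] {γ : ℝ → E} (hK : IsSmoothBody K)
    (hγ : IsFlowLine j K γ) (s t : ℝ) : ‖γ t - γ s‖ ≤ |t - s| := by
  have h := convex_univ.norm_image_sub_le_of_norm_hasDerivWithin_le (C := 1)
    (fun u _ => (hγ.hasDerivAt u).hasDerivWithinAt)
    (fun u _ => by rw [j.norm_map, hK.norm_normal (hγ.mem u)]) (mem_univ s) (mem_univ t)
  simpa using h

/-- Asymptotic expansion of a small step of the outer billiard: up to an error of order less than
two, the tangent direction after the step is that of the characteristic. -/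
lemma IsSmoothBody.tangent_expansion [FiniteDimensional ℝ E] (hK : IsSmoothBody K)
    (hj : ∀ x, j (j x) = -x) {γ : ℝ → E} (hγ : IsFlowLine j K γ)
    (hflat : inner ℝ (normal K (γ 0)) (deriv (deriv γ) 0) ≠ 0) {ι : Type*} {l : Filter ι}
    {h s : ι → ℝ} {m : ι → E} (hh : Tendsto h l (𝓝 0)) (hh0 : ∀ᶠ i in l, 0 < h i)
    (hs0 : ∀ᶠ i in l, 0 < s i) (hm : ∀ᶠ i in l, m i ∈ frontier K)
    (hms : ∀ᶠ i in l, m i = (γ 0 + h i • j (normal K (γ 0))) + s i • j (normal K (m i))) :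
    Tendsto (fun i => h i + s i) l (𝓝 0) ∧
    (fun i => j (normal K (m i)) - j (normal K (γ 0)) - (h i + s i) • deriv (deriv γ) 0
      - ((h i + s i) ^ 2 / 2) • deriv (deriv (deriv γ)) 0) =o[l] fun i => (h i + s i) ^ 2 := by
  set z := γ 0 with hz
  set v : E → E := fun x => j (normal K x) with hv
  set w := deriv (deriv γ) 0 with hw
  set q := deriv (deriv (deriv γ)) 0 with hq
  set τ : ι → ℝ := fun i => h i + s i with hτdef
  have hzfr : z ∈ frontier K := hγ.mem 0
  obtain ⟨Λ, hΛ⟩ := hK.exists_lipschitzOnWith_normal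
  have hN : ∀ x ∈ frontier K, ∀ y ∈ frontier K, ‖normal K x - normal K y‖ ≤ Λ * ‖x - y‖ :=
    fun x hx y hy => by simpa [dist_eq_norm] using hΛ.dist_le_mul x hx y hy
  have hV : ∀ x ∈ frontier K, ∀ y ∈ frontier K, ‖v x - v y‖ ≤ Λ * ‖x - y‖ := fun x hx y hy => by
    rw [hv]; simp only; rw [← map_sub, j.norm_map]; exact hN x hx y hy
  have hv1 : ∀ x ∈ frontier K, ‖v x‖ = 1 := fun x hx => by
    rw [hv]; simp only; rw [j.norm_map, hK.norm_normal hx]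
  have hmz : Tendsto m l (𝓝 z) := by
    refine hK.tendsto_tangent_point hj hzfr (x := fun i => z + h i • v z) ?_ hm hms
    simpa using tendsto_const_nhds.add (hh.smul_const (v z))
  have hs : Tendsto s l (𝓝 0) := by
    have h1 : Tendsto (fun i => ‖m i - (z + h i • v z)‖) l (𝓝 0) := by
      have : Tendsto (fun i => m i - (z + h i • v z)) l (𝓝 (z - (z + (0 : ℝ) • v z))) :=
        hmz.sub (tendsto_const_nhds.add (hh.smul_const (v z)))
      simpa using this.norm
    refine h1.congr' ?_
    filter_upwards [hms, hm, hs0] with i hi hmi hsi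
    have : m i - (z + h i • v z) = s i • v (m i) := by nth_rw 1 [hi]; abel
    rw [this, norm_smul, hv1 _ hmi, mul_one, Real.norm_of_nonneg hsi.le]
  have hτ : Tendsto τ l (𝓝 0) := by simpa using hh.add hs
  refine ⟨hτ, ?_⟩
  have hγ2 : ContDiff ℝ 2 γ := hK.contDiff_of_isFlowLine hγ 2
  have hγ' : ContDiff ℝ 2 (deriv γ) := by
    have h3 := hK.contDiff_of_isFlowLine hγ (2 + 1)
    rw [Nat.cast_succ] at h3
    exact (contDiff_succ_iff_deriv.1 h3).2.2
  have hd : deriv γ = fun t => v (γ t) := hγ.deriv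
  -- the curve and its tangent at time `τ`
  have T1 : (fun i => γ (τ i) - z - τ i • v z - (τ i ^ 2 / 2) • w) =o[l] fun i => τ i ^ 2 := by
    have := (taylor_two_isLittleO hγ2).comp_tendsto hτ
    have h1 : deriv γ 0 = v z := by rw [hd]
    rw [h1] at this
    exact this
  have T2 : (fun i => v (γ (τ i)) - v z - τ i • w - (τ i ^ 2 / 2) • q) =o[l] fun i => τ i ^ 2 := by
    have := (taylor_two_isLittleO hγ').comp_tendsto hτ
    rw [hd] at this
    rw [hw, hq, hd]
    exact this
  have hsτ : s =O[l] τ := by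
    refine IsBigO.of_bound 1 ?_
    filter_upwards [hh0, hs0] with i h1 h2
    rw [Real.norm_of_nonneg h2.le, Real.norm_of_nonneg (add_pos h1 h2).le]
    linarith
  have hττ : (fun i => τ i * τ i ^ 2) =o[l] fun i => τ i ^ 2 := by
    have : τ =o[l] fun _ => (1 : ℝ) := (isLittleO_one_iff ℝ).2 hτ
    simpa using this.mul_isBigO (isBigO_refl (fun i => τ i ^ 2) l)
  -- The tangent point is compared with the characteristic at time `τ`, the total length of the
  -- broken path. Since `v` is Lipschitz and `T2` expands `v (γ τ)`, it suffices that `e = o(τ²)`.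
  set e : ι → E := fun i => m i - γ (τ i) with he
  have hVe : (fun i => v (m i) - v (γ (τ i))) =O[l] e := by
    refine IsBigO.of_bound Λ ?_
    filter_upwards [hm] with i hi
    exact hV _ hi _ (hγ.mem _)
  -- `e = s (v m - v γ) + (s τ - τ²/2) w + o(τ²)`
  have hR : (fun i => e i - s i • (v (m i) - v (γ (τ i))) - (s i * τ i - τ i ^ 2 / 2) • w)
      =o[l] fun i => τ i ^ 2 := by
    have h1 : (fun i => s i • ((v (γ (τ i)) - v z - τ i • w - (τ i ^ 2 / 2) • q)
        + (τ i ^ 2 / 2) • q)) =o[l] fun i => τ i ^ 2 := by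
      have h2 : (fun i => (v (γ (τ i)) - v z - τ i • w - (τ i ^ 2 / 2) • q)
          + (τ i ^ 2 / 2) • q) =O[l] fun i => τ i ^ 2 := by
        refine T2.isBigO.add ?_
        refine IsBigO.of_bound (‖q‖ / 2) (Eventually.of_forall fun i => ?_)
        rw [norm_smul, norm_div]
        apply le_of_eq; simp; ring
      have h3 : (fun i => s i • ((v (γ (τ i)) - v z - τ i • w - (τ i ^ 2 / 2) • q)
          + (τ i ^ 2 / 2) • q)) =O[l] fun i => τ i * τ i ^ 2 := hsτ.smul h2
      exact h3.trans_isLittleO hττ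
    refine (h1.sub T1).congr' ?_ (EventuallyEq.refl _ _)
    filter_upwards [hms] with i hi
    have e1 : e i = (z + h i • v z) + s i • v (m i) - γ (τ i) := by rw [he]; simp only; rw [← hi]
    rw [e1]
    have e2 : h i = τ i - s i := by simp [hτdef]
    rw [e2]
    module
  have hsw : (fun i => (s i * τ i - τ i ^ 2 / 2) • w) =O[l] fun i => τ i ^ 2 := by
    have h1 : (fun i => s i * τ i - τ i ^ 2 / 2) =O[l] fun i => τ i ^ 2 := by
      have h2 : (fun i => s i * τ i) =O[l] fun i => τ i ^ 2 := by
        simpa [sq] using hsτ.mul (isBigO_refl τ l)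
      refine h2.sub ?_
      simpa [div_eq_inv_mul] using (isBigO_refl (fun i => τ i ^ 2) l).const_mul_left (2⁻¹)
    simpa using h1.smul (isBigO_const_const w (one_ne_zero (α := ℝ)) l)
  -- Being small compared with `e`, this term can be absorbed, which gives the a priori bound `e =
  -- O(τ²)`.
  have hse : (fun i => s i • (v (m i) - v (γ (τ i)))) =o[l] e := by
    have h1 : s =o[l] fun _ => (1 : ℝ) := (isLittleO_one_iff ℝ).2 hs
    simpa using h1.smul_isBigO hVe
  have heO : e =O[l] fun i => τ i ^ 2 := by
    have h1 : (fun i => e i - s i • (v (m i) - v (γ (τ i)))) =O[l] fun i => τ i ^ 2 := by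
      refine (hR.isBigO.add hsw).congr_left fun i => ?_
      abel
    have h2 : e =O[l] fun i => e i - s i • (v (m i) - v (γ (τ i))) := hse.right_isBigO_sub
    exact h2.trans h1
  have hR' : (fun i => e i - (s i * τ i - τ i ^ 2 / 2) • w) =o[l] fun i => τ i ^ 2 := by
    refine (hR.add (hse.trans_isBigO heO)).congr_left fun i => ?_
    abel
  -- Both `m` and `γ τ` lie on the boundary, so the supporting hyperplanes at these two points bound
  -- the normal component of `e` from either side; replacing their normals by the one at `z` costs
  -- only `o(1) ‖e‖`.
  have hin : (fun i => inner ℝ (normal K z) (e i)) =o[l] fun i => τ i ^ 2 := by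
    have hb : (fun i => max ‖m i - z‖ ‖γ (τ i) - z‖) =o[l] fun _ => (1 : ℝ) := by
      rw [isLittleO_one_iff]
      have h1 : Tendsto (fun i => ‖m i - z‖) l (𝓝 0) := by simpa using (hmz.sub_const z).norm
      have h2 : Tendsto (fun i => ‖γ (τ i) - z‖) l (𝓝 0) := by
        have : Tendsto (fun i => γ (τ i)) l (𝓝 z) := (hγ.continuous.tendsto 0).comp hτ
        simpa using (this.sub_const z).norm
      simpa using h1.max h2
    have h3 : (fun i => inner ℝ (normal K z) (e i))
        =O[l] fun i => max ‖m i - z‖ ‖γ (τ i) - z‖ * ‖e i‖ := by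
      refine IsBigO.of_bound Λ ?_
      filter_upwards [hm] with i hi
      have h4 := hK.inner_normal_le (hγ.mem (τ i)) (hK.frontier_subset hi)
      have h5 := hK.inner_normal_le hi (hK.frontier_subset (hγ.mem (τ i)))
      have e1 : γ (τ i) - m i = -e i := by rw [he]; simp
      rw [e1, inner_neg_right] at h5
      have h6 := (abs_le.1 (abs_real_inner_le_norm (normal K (γ (τ i)) - normal K z) (e i))).1
      have h7 := (abs_le.1 (abs_real_inner_le_norm (normal K (m i) - normal K z) (e i))).2
      rw [inner_sub_left] at h6 h7
      have h8 : ‖normal K (γ (τ i)) - normal K z‖ * ‖e i‖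
          ≤ Λ * (max ‖m i - z‖ ‖γ (τ i) - z‖ * ‖e i‖) := by
        rw [← mul_assoc]
        gcongr
        exact (hN _ (hγ.mem _) _ hzfr).trans (by gcongr; exact le_max_right _ _)
      have h9 : ‖normal K (m i) - normal K z‖ * ‖e i‖
          ≤ Λ * (max ‖m i - z‖ ‖γ (τ i) - z‖ * ‖e i‖) := by
        rw [← mul_assoc]
        gcongr
        exact (hN _ hi _ hzfr).trans (by gcongr; exact le_max_left _ _)
      rw [Real.norm_of_nonneg (by positivity : 0 ≤ max ‖m i - z‖ ‖γ (τ i) - z‖ * ‖e i‖),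
        Real.norm_eq_abs, abs_le]
      change inner ℝ (normal K (γ (τ i))) (e i) ≤ 0 at h4
      constructor <;> linarith
    refine h3.trans_isLittleO ?_
    simpa using hb.mul_isBigO heO.norm_left
  -- Here the curvature hypothesis enters: `w` has a nonzero normal component, so smallness of the
  -- normal component of `e` forces `s = τ / 2` to leading order.
  have hc : (fun i => s i * τ i - τ i ^ 2 / 2) =o[l] fun i => τ i ^ 2 := by
    have h1 : (fun i => inner ℝ (normal K z) (e i - (s i * τ i - τ i ^ 2 / 2) • w))
        =o[l] fun i => τ i ^ 2 := by
      refine IsBigO.trans_isLittleO (IsBigO.of_bound ‖normal K z‖ ?_) hR'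
      exact Eventually.of_forall fun i => norm_inner_le_norm _ _
    have h2 := (hin.sub h1).const_mul_left (inner ℝ (normal K z) w)⁻¹
    refine h2.congr_left fun i => ?_
    rw [inner_sub_right (normal K z) (e i), inner_smul_right]
    field_simp
    ring
  have heo : e =o[l] fun i => τ i ^ 2 := by
    have h1 : (fun i => (s i * τ i - τ i ^ 2 / 2) • w) =o[l] fun i => τ i ^ 2 := by
      simpa using hc.smul_isBigO
        (isBigO_const_const w (one_ne_zero (α := ℝ)) l)
    refine (hR'.add h1).congr_left fun i => ?_
    abel
  refine ((hVe.trans_isLittleO heo).add T2).congr_left fun i => ?_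
  simp only [hv, hτdef]
  abel

end OuterBilliard

/-! ### From planar billiard chains to dependent derivatives -/

namespace OuterBilliard

variable {E : Type*} [NormedAddCommGroup E] [InnerProductSpace ℝ E]
variable {j : E →ₗᵢ[ℝ] E} {K : Set E}

/-- Any three consecutive tangent directions of an outer billiard are linearly dependent. -/
def HasPlanarChains (j : E →ₗᵢ[ℝ] E) (K : Set E) : Prop :=
  ∀ a ∈ frontier K, ∀ b ∈ frontier K, ∀ c ∈ frontier K, ∀ r s t : ℝ, 0 < r → 0 < s → 0 < t →
    b - a = r • j (normal K a) + s • j (normal K b) →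
    c - b = s • j (normal K b) + t • j (normal K c) →
    ¬ LinearIndependent ℝ ![j (normal K a), j (normal K b), j (normal K c)]

/-- The opposite rotation. -/
def negRotation (j : E →ₗᵢ[ℝ] E) : E →ₗᵢ[ℝ] E := (LinearIsometryEquiv.neg ℝ).toLinearIsometry.comp j

lemma negRotation_apply (j : E →ₗᵢ[ℝ] E) (x : E) : negRotation j x = -j x := rfl

lemma negRotation_negRotation (hj : ∀ x, j (j x) = -x) (x : E) :
    negRotation j (negRotation j x) = -x := by
  simp [negRotation_apply, hj]

/-- Time reversal lets backward billiard steps be treated as forward steps for the opposite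
rotation. -/
lemma IsFlowLine.comp_neg {γ : ℝ → E} (hγ : IsFlowLine j K γ) :
    IsFlowLine (negRotation j) K (fun t => γ (-t)) :=
  ⟨fun _ => hγ.mem _, fun t => by
    have := (hγ.hasDerivAt (-t)).scomp t (hasDerivAt_neg t)
    rw [neg_one_smul] at this
    exact this⟩

/-- A limit of triples of vectors spanned by linearly dependent triples is linearly dependent. -/
lemma not_linearIndependent_of_tendsto [FiniteDimensional ℝ E] {ι : Type*} {l : Filter ι} [l.NeBot]
    {a b c x y : ι → E} {x₀ a₀ b₀ : E}
    (hdep : ∀ᶠ i in l, ¬ LinearIndependent ℝ ![a i, b i, c i])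
    (h0 : ∀ᶠ i in l, x₀ ∈ Submodule.span ℝ (range ![a i, b i, c i]))
    (h1 : ∀ᶠ i in l, x i ∈ Submodule.span ℝ (range ![a i, b i, c i]))
    (h2 : ∀ᶠ i in l, y i ∈ Submodule.span ℝ (range ![a i, b i, c i]))
    (hxl : Tendsto x l (𝓝 a₀)) (hyl : Tendsto y l (𝓝 b₀)) :
    ¬ LinearIndependent ℝ ![x₀, a₀, b₀] := by
  intro hli
  have hlim : Tendsto (fun i => ![x₀, x i, y i]) l (𝓝 ![x₀, a₀, b₀]) := by
    rw [tendsto_pi_nhds]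
    intro k
    fin_cases k
    · exact tendsto_const_nhds
    · exact hxl
    · exact hyl
  obtain ⟨i, hi, hd, h0, h1, h2⟩ := ((hlim.eventually hli.eventually).and
    (hdep.and (h0.and (h1.and h2)))).exists
  -- Independence is an open condition, so an independent limit would put three independent vectors
  -- into a span of dimension at most two.
  have hle : Submodule.span ℝ (range ![x₀, x i, y i])
      ≤ Submodule.span ℝ (range ![a i, b i, c i]) := by
    rw [Submodule.span_le]
    rintro _ ⟨k, rfl⟩
    fin_cases k
    · exact h0
    · exact h1
    · exact h2
  have e1 := finrank_span_eq_card hi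
  have e2 : Set.finrank ℝ (range ![a i, b i, c i]) ≤ 3 := by
    simpa using finrank_range_le_card (R := ℝ) ![a i, b i, c i]
  have e3 := Submodule.finrank_mono hle
  rw [e1] at e3
  refine hd (linearIndependent_iff_card_eq_finrank_span.2 ?_)
  exact le_antisymm e3 e2

open Asymptotics in
-- Steps of half-length `h` along the tangent at `γ 0`, forward to a tangent point `m` and backward
-- to `m'`, give a chain with dependent directions. First and second divided differences of these
-- directions stay in their span and converge to the second and third derivatives.
lemma IsSmoothBody.not_linearIndependent_deriv [FiniteDimensional ℝ E] (hK : IsSmoothBody K)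
    (hj : ∀ x, j (j x) = -x) (hpl : HasPlanarChains j K) {γ : ℝ → E} (hγ : IsFlowLine j K γ)
    (hflat : inner ℝ (normal K (γ 0)) (deriv (deriv γ) 0) ≠ 0) :
    ¬ LinearIndependent ℝ ![deriv γ 0, deriv (deriv γ) 0, deriv (deriv (deriv γ)) 0] := by
  have hz := hγ.mem 0
  have hj' := negRotation_negRotation hj
  have hex : ∀ h : ℝ, ∃ (m : E) (s : ℝ), 0 < h → m ∈ frontier K ∧ 0 < s ∧
      m = (γ 0 + h • j (normal K (γ 0))) + s • j (normal K m) := fun h => by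
    rcases le_or_gt h 0 with h0 | h0
    · exact ⟨0, 0, fun h1 => absurd h1 (not_lt.2 h0)⟩
    · obtain ⟨m, hm, s, hs, e⟩ := hK.exists_tangent_point hj (hK.add_smul_notMem hj hz h0.ne')
      exact ⟨m, s, fun _ => ⟨hm, hs, e⟩⟩
  have hex' : ∀ h : ℝ, ∃ (m : E) (s : ℝ), 0 < h → m ∈ frontier K ∧ 0 < s ∧
      m = (γ 0 + h • negRotation j (normal K (γ 0))) + s • negRotation j (normal K m) :=
    fun h => by
    rcases le_or_gt h 0 with h0 | h0
    · exact ⟨0, 0, fun h1 => absurd h1 (not_lt.2 h0)⟩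
    · obtain ⟨m, hm, s, hs, e⟩ := hK.exists_tangent_point hj' (hK.add_smul_notMem hj' hz h0.ne')
      exact ⟨m, s, fun _ => ⟨hm, hs, e⟩⟩
  choose m s hms using hex
  choose m' s' hms' using hex'
  have hpos : ∀ᶠ h : ℝ in 𝓝[>] 0, 0 < h := self_mem_nhdsWithin
  have hid : Tendsto (fun h : ℝ => h) (𝓝[>] 0) (𝓝 0) := nhdsWithin_le_nhds
  obtain ⟨hτ, hexp⟩ := hK.tangent_expansion hj hγ hflat hid hpos
    (hpos.mono fun h hh => (hms h hh).2.1) (hpos.mono fun h hh => (hms h hh).1)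
    (hpos.mono fun h hh => (hms h hh).2.2)
  have hd1 : deriv (fun t => γ (-t)) = fun t => -deriv γ (-t) := funext fun t => deriv_comp_neg _ _
  have hd2 : deriv (deriv (fun t => γ (-t))) = fun t => deriv (deriv γ) (-t) := by
    rw [hd1]; funext t
    rw [deriv.fun_neg, deriv_comp_neg, neg_neg]
  have hd3 : deriv (deriv (deriv (fun t => γ (-t)))) = fun t => -deriv (deriv (deriv γ)) (-t) := by
    rw [hd2]; funext t
    rw [deriv_comp_neg]
  obtain ⟨hτ', hexp'⟩ := hK.tangent_expansion hj' hγ.comp_neg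
    (by rw [hd2]; simpa only [neg_zero] using hflat) hid hpos
    (hpos.mono fun h hh => (hms' h hh).2.1) (hpos.mono fun h hh => (hms' h hh).1)
    (hpos.mono fun h hh => by rw [neg_zero]; exact (hms' h hh).2.2)
  rw [hd3, hd2] at hexp'
  simp only [neg_zero, negRotation_apply] at hexp'
  have hv0 : j (normal K (γ 0)) = deriv γ 0 := by rw [hγ.deriv]
  rw [hv0] at hexp hexp'
  set v₀ := deriv γ 0
  set w := deriv (deriv γ) 0
  set q := deriv (deriv (deriv γ)) 0
  set τ : ℝ → ℝ := fun h => h + s h with hτdef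
  set τ' : ℝ → ℝ := fun h => h + s' h with hτdef'
  set ρ : ℝ → E := fun h => j (normal K (m h)) - v₀ - τ h • w - (τ h ^ 2 / 2) • q with hρ
  set ρ' : ℝ → E := fun h => -(-j (normal K (m' h)) - -v₀ - τ' h • w - (τ' h ^ 2 / 2) • -q) with hρ'
  have hexp' : ρ' =o[𝓝[>] 0] fun h => τ' h ^ 2 := hexp'.neg_left
  have hτp : ∀ᶠ h in 𝓝[>] 0, 0 < τ h := hpos.mono fun h hh => add_pos hh (hms h hh).2.1
  have hτp' : ∀ᶠ h in 𝓝[>] 0, 0 < τ' h := hpos.mono fun h hh => add_pos hh (hms' h hh).2.1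
  have key : ∀ (ρ : ℝ → E) (τ : ℝ → ℝ), ρ =o[𝓝[>] 0] (fun h => τ h ^ 2) →
      (∀ᶠ h in 𝓝[>] 0, 0 < τ h) → (fun h => (τ h)⁻¹ • ρ h) =o[𝓝[>] 0] τ := by
    intro ρ τ h1 h2
    have := (isBigO_refl (fun h => (τ h)⁻¹) (𝓝[>] 0)).smul_isLittleO h1
    refine this.congr' (EventuallyEq.refl _ _) ?_
    filter_upwards [h2] with h hh
    rw [smul_eq_mul]; field_simp
  have hσ := key ρ τ hexp hτp
  have hσ' := key ρ' τ' hexp' hτp'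
  have hX : Tendsto (fun h => (τ h)⁻¹ • (j (normal K (m h)) - v₀)) (𝓝[>] 0) (𝓝 w) := by
    have h1 : Tendsto (fun h => w + (τ h / 2) • q + (τ h)⁻¹ • ρ h) (𝓝[>] 0)
        (𝓝 (w + ((0 : ℝ) / 2) • q + 0)) :=
      (tendsto_const_nhds.add ((hτ.div_const 2).smul_const q)).add
        (hσ.trans_tendsto hτ)
    rw [zero_div, zero_smul, add_zero, add_zero] at h1
    refine h1.congr' ?_
    filter_upwards [hτp] with h hh
    have e : j (normal K (m h)) - v₀ = τ h • w + (τ h ^ 2 / 2) • q + ρ h := by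
      rw [hρ]; module
    rw [e, smul_add, smul_add, smul_smul, smul_smul, inv_mul_cancel₀ hh.ne', one_smul]
    congr 3
    field_simp
  -- Since `τ` and `τ'` may differ, each difference is divided by its own time; the terms in `w`
  -- then cancel exactly and `q` is left with coefficient `(τ + τ') / 2`.
  have hY : Tendsto (fun h => (2 / (τ h + τ' h)) • ((τ h)⁻¹ • (j (normal K (m h)) - v₀)
      + (τ' h)⁻¹ • (j (normal K (m' h)) - v₀))) (𝓝[>] 0) (𝓝 q) := by
    have h0 : (fun h => (τ h)⁻¹ • ρ h + (τ' h)⁻¹ • ρ' h) =o[𝓝[>] 0] fun h => τ h + τ' h := by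
      have b1 : τ =O[𝓝[>] 0] fun h => τ h + τ' h := by
        refine IsBigO.of_bound 1 ?_
        filter_upwards [hτp, hτp'] with h h1 h2
        rw [Real.norm_of_nonneg h1.le, Real.norm_of_nonneg (add_pos h1 h2).le]; linarith
      have b2 : τ' =O[𝓝[>] 0] fun h => τ h + τ' h := by
        refine IsBigO.of_bound 1 ?_
        filter_upwards [hτp, hτp'] with h h1 h2
        rw [Real.norm_of_nonneg h2.le, Real.norm_of_nonneg (add_pos h1 h2).le]; linarith
      exact (hσ.trans_isBigO b1).add (hσ'.trans_isBigO b2)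
    have h0' : Tendsto (fun h => (τ h + τ' h)⁻¹ • ((τ h)⁻¹ • ρ h + (τ' h)⁻¹ • ρ' h)) (𝓝[>] 0)
        (𝓝 0) := by
      rw [← isLittleO_one_iff ℝ]
      refine ((isBigO_refl (fun h => (τ h + τ' h)⁻¹) (𝓝[>] 0)).smul_isLittleO h0).congr'
        (EventuallyEq.refl _ _) ?_
      filter_upwards [hτp, hτp'] with h hh hh'
      exact inv_mul_cancel₀ (add_pos hh hh').ne'
    have h1 : Tendsto (fun h => q + (2 : ℝ) • (τ h + τ' h)⁻¹ •
        ((τ h)⁻¹ • ρ h + (τ' h)⁻¹ • ρ' h)) (𝓝[>] 0) (𝓝 (q + (2 : ℝ) • 0)) :=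
      tendsto_const_nhds.add (h0'.const_smul 2)
    rw [smul_zero, add_zero] at h1
    refine h1.congr' ?_
    filter_upwards [hτp, hτp'] with h hh hh'
    have e : j (normal K (m h)) - v₀ = τ h • w + (τ h ^ 2 / 2) • q + ρ h := by
      rw [hρ]; module
    have e' : j (normal K (m' h)) - v₀ = -(τ' h • w) + (τ' h ^ 2 / 2) • q + ρ' h := by
      rw [hρ']; module
    rw [e, e']
    have hs := (add_pos hh hh').ne'
    match_scalars <;> field_simp <;> ring
  refine not_linearIndependent_of_tendsto (l := 𝓝[>] (0 : ℝ))
    (a := fun h => j (normal K (m' h))) (b := fun _ => v₀) (c := fun h => j (normal K (m h)))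
    ?_ ?_ ?_ ?_ hX hY
  · filter_upwards [hpos] with h hh
    have h1 := hms h hh
    have h2 := hms' h hh
    have := hpl _ h2.1 _ hz _ h1.1 (s' h) h (s h) h2.2.1 hh h1.2.1 (by
      have := h2.2.2
      simp only [negRotation_apply] at this
      nth_rw 1 [this]
      module) (by
      nth_rw 1 [h1.2.2]
      abel)
    rwa [hv0] at this
  all_goals refine Eventually.of_forall fun h => ?_
  · exact Submodule.subset_span ⟨1, rfl⟩
  all_goals
    have h1 : j (normal K (m h)) ∈ Submodule.span ℝ
      (range ![j (normal K (m' h)), v₀, j (normal K (m h))]) := Submodule.subset_span ⟨2, rfl⟩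
    have h2 : v₀ ∈ Submodule.span ℝ
      (range ![j (normal K (m' h)), v₀, j (normal K (m h))]) := Submodule.subset_span ⟨1, rfl⟩
    have h3 : j (normal K (m' h)) ∈ Submodule.span ℝ
      (range ![j (normal K (m' h)), v₀, j (normal K (m h))]) := Submodule.subset_span ⟨0, rfl⟩
  · exact Submodule.smul_mem _ _ (Submodule.sub_mem _ h1 h2)
  · exact Submodule.smul_mem _ _ (Submodule.add_mem _
      (Submodule.smul_mem _ _ (Submodule.sub_mem _ h1 h2))
      (Submodule.smul_mem _ _ (Submodule.sub_mem _ h3 h2)))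

end OuterBilliard

/-! ### Curved times and planar arcs of characteristics -/

namespace OuterBilliard

variable {E : Type*} [NormedAddCommGroup E] [InnerProductSpace ℝ E]
variable {j : E →ₗᵢ[ℝ] E} {K : Set E}

lemma deriv_shift (γ : ℝ → E) (a : ℝ) : deriv (fun t => γ (t + a)) = fun t => deriv γ (t + a) :=
  funext fun _ => deriv_comp_add_const _ _ _

variable [FiniteDimensional ℝ E]

namespace IsSmoothBody

lemma contDiff_deriv (hK : IsSmoothBody K) {γ : ℝ → E} (hγ : IsFlowLine j K γ) (n : ℕ) :
    ContDiff ℝ n (deriv γ) := by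
  have h := hK.contDiff_of_isFlowLine hγ (n + 1)
  rw [Nat.cast_succ] at h
  exact (contDiff_succ_iff_deriv.1 h).2.2

lemma contDiff_deriv_deriv (hK : IsSmoothBody K) {γ : ℝ → E} (hγ : IsFlowLine j K γ) (n : ℕ) :
    ContDiff ℝ n (deriv (deriv γ)) := by
  have h := hK.contDiff_deriv hγ (n + 1)
  rw [Nat.cast_succ] at h
  exact (contDiff_succ_iff_deriv.1 h).2.2

lemma norm_deriv (hK : IsSmoothBody K) {γ : ℝ → E} (hγ : IsFlowLine j K γ) (t : ℝ) :
    ‖deriv γ t‖ = 1 := by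
  rw [hγ.deriv, j.norm_map, hK.norm_normal (hγ.mem t)]

open Asymptotics in
/-- If the normal curvature of the boundary vanishes in the characteristic direction, then the
characteristic has no curvature at all. -/
lemma deriv_deriv_eq_zero (hK : IsSmoothBody K) (hj : ∀ x, j (j x) = -x) {γ : ℝ → E}
    (hγ : IsFlowLine j K γ) (hflat : inner ℝ (normal K (γ 0)) (deriv (deriv γ) 0) = 0) :
    deriv (deriv γ) 0 = 0 := by
  obtain ⟨r, hr, hroll⟩ := hK.exists_rolling_ball
  have hT := taylor_two_isLittleO (hK.contDiff_of_isFlowLine hγ 2)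
  have hin : (fun t => inner ℝ (normal K (γ 0)) (γ 0 - γ t)) =o[𝓝 0] fun t : ℝ => t ^ 2 := by
    refine IsBigO.trans_isLittleO (IsBigO.of_bound 1 (Eventually.of_forall fun t => ?_)) hT
    have e : inner ℝ (normal K (γ 0)) (γ 0 - γ t) = -inner ℝ (normal K (γ 0))
        (γ t - γ 0 - t • deriv γ 0 - (t ^ 2 / 2) • deriv (deriv γ) 0) := by
      have h1 : inner ℝ (normal K (γ 0)) (deriv γ 0) = 0 := by
        rw [hγ.deriv, inner_self_map hj]
      simp only [inner_sub_right, inner_smul_right, hflat, h1]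
      ring
    rw [e, norm_neg, one_mul]
    refine (norm_inner_le_norm _ _).trans ?_
    rw [hK.norm_normal (hγ.mem 0), one_mul]
  -- The rolling ball bounds the squared turning of the normal by the height below the tangent
  -- hyperplane, which is `o(t²)` by flatness.
  have hsq : (fun t => ‖deriv γ t - deriv γ 0‖ ^ 2) =o[𝓝 0] fun t : ℝ => t ^ 2 := by
    refine IsBigO.trans_isLittleO (IsBigO.of_bound (2 / r) (Eventually.of_forall fun t => ?_)) hin
    have h := hK.sq_norm_normal_sub_le hr hroll (hγ.mem 0) (hγ.mem t)
    rw [hγ.deriv]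
    simp only
    rw [← map_sub, j.norm_map, norm_sub_rev, Real.norm_of_nonneg (by positivity),
      Real.norm_of_nonneg (le_trans (by positivity) h), div_mul_eq_mul_div, le_div_iff₀ hr]
    linarith
  have hlin : (fun t => deriv γ t - deriv γ 0) =o[𝓝 0] fun t : ℝ => t := by
    rw [← isLittleO_norm_left]
    refine IsLittleO.of_pow (n := 2) hsq two_ne_zero
  have hd : HasDerivAt (deriv γ) 0 0 := by
    rw [hasDerivAt_iff_isLittleO]
    simpa using hlin
  exact hd.deriv

/-- Every characteristic has a time at which the normal curvature does not vanish. -/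
lemma exists_curved_time (hK : IsSmoothBody K) (hj : ∀ x, j (j x) = -x) {γ : ℝ → E}
    (hγ : IsFlowLine j K γ) : ∃ t, inner ℝ (normal K (γ t)) (deriv (deriv γ) t) ≠ 0 := by
  by_contra! hflat
  have h0 : ∀ t, deriv (deriv γ) t = 0 := fun t => by
    have h := hK.deriv_deriv_eq_zero hj (hγ.comp_add t) (by
      rw [deriv_shift, deriv_shift]; simpa using hflat t)
    rw [deriv_shift, deriv_shift] at h
    simpa using h
  have hc : ∀ t, deriv γ t = deriv γ 0 := fun t =>
    is_const_of_deriv_eq_zero ((hK.contDiff_deriv hγ 1).differentiable (by simp)) h0 t 0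
  have hn : ∀ t, normal K (γ t) = normal K (γ 0) := fun t => by
    have := hc t
    rw [hγ.deriv] at this
    exact j.injective this
  -- Without curvature the normal is constant along the curve; strict convexity allows one boundary
  -- point per normal, contradicting unit speed.
  have hγc : ∀ t, γ t = γ 0 := fun t => by
    by_contra hne
    have h1 := hK.inner_normal_lt (hγ.mem t) (hK.frontier_subset (hγ.mem 0)) (Ne.symm hne)
    have h2 := hK.inner_normal_lt (hγ.mem 0) (hK.frontier_subset (hγ.mem t)) hne
    rw [hn, ← neg_sub, inner_neg_right] at h1
    linarith
  have h1 := hK.norm_deriv hγ 0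
  have h2 : γ = fun _ => γ 0 := funext hγc
  rw [h2, deriv_const, norm_zero] at h1
  exact zero_ne_one h1

lemma inner_deriv_deriv_deriv (hK : IsSmoothBody K) {γ : ℝ → E} (hγ : IsFlowLine j K γ) (t : ℝ) :
    inner ℝ (deriv γ t) (deriv (deriv γ) t) = 0 := by
  have hd := ((hK.contDiff_deriv hγ 1).differentiable (by simp) t).hasDerivAt
  have h1 := hd.inner ℝ hd
  have h2 : (fun t => inner ℝ (deriv γ t) (deriv γ t)) = fun _ => (1 : ℝ) := funext fun t => by
    rw [real_inner_self_eq_norm_sq, hK.norm_deriv hγ, one_pow]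
  rw [h2] at h1
  have h3 := h1.unique (hasDerivAt_const t 1)
  rw [real_inner_comm (deriv γ t) (deriv (deriv γ) t)] at h3
  linarith

lemma linearIndependent_deriv (hK : IsSmoothBody K) {γ : ℝ → E} (hγ : IsFlowLine j K γ) {t : ℝ}
    (hcurv : deriv (deriv γ) t ≠ 0) : LinearIndependent ℝ ![deriv γ t, deriv (deriv γ) t] := by
  have h22 : 0 < ‖deriv (deriv γ) t‖ := norm_pos_iff.2 hcurv
  have horth := hK.inner_deriv_deriv_deriv hγ t
  rw [LinearIndependent.pair_iff]
  intro x y hxy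
  have h1 := congrArg (inner ℝ (deriv γ t)) hxy
  have h2 := congrArg (inner ℝ (deriv (deriv γ) t)) hxy
  simp only [inner_add_right, inner_smul_right, horth, inner_zero_right,
    real_inner_self_eq_norm_sq, hK.norm_deriv hγ,
    real_inner_comm (deriv γ t) (deriv (deriv γ) t)] at h1 h2
  refine ⟨by linarith, ?_⟩
  have : y * ‖deriv (deriv γ) t‖ ^ 2 = 0 := by linarith
  exact (mul_eq_zero.1 this).resolve_right (by positivity)

/-- If the first three derivatives of a unit-speed curve are dependent while the second one does
not vanish, then the curve is planar. -/
lemma deriv_mem_span (hK : IsSmoothBody K) {γ : ℝ → E} (hγ : IsFlowLine j K γ) {a b : ℝ}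
    (hcurv : ∀ t ∈ Icc a b, deriv (deriv γ) t ≠ 0)
    (hdep : ∀ t ∈ Icc a b,
      ¬ LinearIndependent ℝ ![deriv γ t, deriv (deriv γ) t, deriv (deriv (deriv γ)) t]) :
    ∀ t ∈ Icc a b, deriv γ t ∈ Submodule.span ℝ {deriv γ a, deriv (deriv γ) a} := by
  set d₁ := deriv γ with hd₁
  set d₂ := deriv d₁ with hd₂
  set d₃ := deriv d₂ with hd₃
  have hd₁' : ∀ t, HasDerivAt d₁ (d₂ t) t := fun t =>
    ((hK.contDiff_deriv hγ 1).differentiable (by simp) t).hasDerivAt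
  have hd₂' : ∀ t, HasDerivAt d₂ (d₃ t) t := fun t =>
    ((hK.contDiff_deriv_deriv hγ 1).differentiable (by simp) t).hasDerivAt
  have hc₁ : Continuous d₁ := (hK.contDiff_deriv hγ 0).continuous
  have hc₂ : Continuous d₂ := (hK.contDiff_deriv_deriv hγ 0).continuous
  have hc₃ : Continuous d₃ := by
    have h := hK.contDiff_deriv_deriv hγ (0 + 1)
    rw [Nat.cast_succ] at h
    exact (contDiff_succ_iff_deriv.1 h).2.2.continuous
  have hn₁ : ∀ t, inner ℝ (d₁ t) (d₁ t) = 1 := fun t => by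
    rw [real_inner_self_eq_norm_sq, hK.norm_deriv hγ, one_pow]
  have horth : ∀ t, inner ℝ (d₁ t) (d₂ t) = 0 := hK.inner_deriv_deriv_deriv hγ
  -- the linear differential equation
  set α : ℝ → ℝ := fun t => inner ℝ (d₁ t) (d₃ t)
  set β : ℝ → ℝ := fun t => inner ℝ (d₂ t) (d₃ t) / ‖d₂ t‖ ^ 2
  have heq : ∀ t ∈ Icc a b, d₃ t = α t • d₁ t + β t • d₂ t := fun t ht => by
    have h22 : 0 < ‖d₂ t‖ := norm_pos_iff.2 (hcurv t ht)
    have hind := hK.linearIndependent_deriv hγ (hcurv t ht)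
    have hmem : d₃ t ∈ Submodule.span ℝ {d₁ t, d₂ t} := by
      by_contra hnot
      refine hdep t ht ?_
      rw [show ![d₁ t, d₂ t, d₃ t] = Fin.snoc ![d₁ t, d₂ t] (d₃ t) from by
        ext k; fin_cases k <;> rfl]
      refine hind.finSnoc ?_
      rw [Set.pair_comm] at hnot
      simpa using hnot
    obtain ⟨x, y, hxy⟩ := Submodule.mem_span_pair.1 hmem
    have h1 : α t = x := by
      simp only [α, ← hxy, inner_add_right, inner_smul_right, hn₁, horth]; ring
    have h2 : β t = y := by
      simp only [β, ← hxy, inner_add_right, inner_smul_right, real_inner_comm (d₁ t) (d₂ t),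
        horth, real_inner_self_eq_norm_sq]
      field_simp; ring
    rw [h1, h2, hxy]
  set S := Submodule.span ℝ {d₁ a, d₂ a} with hS
  -- The components of the first two derivatives orthogonal to `S` solve a linear system with
  -- bounded coefficients and vanish at `a`, so Grönwall's inequality makes them vanish throughout.
  set Q : E →L[ℝ] E := Sᗮ.starProjection with hQ
  have hQ0 : ∀ x, Q x = 0 ↔ x ∈ S := fun x => by
    rw [hQ, Submodule.starProjection_apply_eq_zero_iff, Submodule.orthogonal_orthogonal]
  have hβc : ContinuousOn β (Icc a b) :=
    ((hc₂.inner hc₃).continuousOn).div (hc₂.norm.pow 2).continuousOn fun t ht => by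
      have := norm_pos_iff.2 (hcurv t ht); positivity
  have hαc : ContinuousOn α (Icc a b) := (hc₁.inner hc₃).continuousOn
  obtain ⟨A, hA⟩ := isCompact_Icc.exists_bound_of_continuousOn hαc
  obtain ⟨B, hB⟩ := isCompact_Icc.exists_bound_of_continuousOn hβc
  have hzero := eq_zero_of_abs_deriv_le_mul_abs_self_of_eq_zero_right
    (f := fun t => (Q (d₁ t), Q (d₂ t))) (f' := fun t => (Q (d₂ t), Q (d₃ t)))
    (K := |A| + |B| + 1) (a := a) (b := b) (by fun_prop)
    (fun t _ => (((Q.hasFDerivAt.comp_hasDerivAt t (hd₁' t)).prodMk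
      (Q.hasFDerivAt.comp_hasDerivAt t (hd₂' t)))).hasDerivWithinAt)
    (by
      have h1 : Q (d₁ a) = 0 := (hQ0 _).2 (Submodule.subset_span (by simp))
      have h2 : Q (d₂ a) = 0 := (hQ0 _).2 (Submodule.subset_span (by simp))
      simp [h1, h2])
    (fun t ht => by
      have ht' := Ico_subset_Icc_self ht
      have h1 : ‖Q (d₁ t)‖ ≤ max ‖Q (d₁ t)‖ ‖Q (d₂ t)‖ := le_max_left _ _
      have h2 : ‖Q (d₂ t)‖ ≤ max ‖Q (d₁ t)‖ ‖Q (d₂ t)‖ := le_max_right _ _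
      simp only [Prod.norm_mk]
      set M := max ‖Q (d₁ t)‖ ‖Q (d₂ t)‖
      have hM : 0 ≤ M := (norm_nonneg _).trans h1
      refine max_le ?_ ?_
      · nlinarith [abs_nonneg A, abs_nonneg B]
      · rw [heq t ht', map_add, map_smul, map_smul]
        refine (norm_add_le _ _).trans ?_
        rw [norm_smul, norm_smul]
        have h3 : ‖α t‖ * ‖Q (d₁ t)‖ ≤ |A| * M :=
          mul_le_mul ((hA t ht').trans (le_abs_self A)) h1 (norm_nonneg _) (abs_nonneg _)
        have h4 : ‖β t‖ * ‖Q (d₂ t)‖ ≤ |B| * M :=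
          mul_le_mul ((hB t ht').trans (le_abs_self B)) h2 (norm_nonneg _) (abs_nonneg _)
        nlinarith)
  intro t ht
  exact (hQ0 _).1 (Prod.mk.inj (hzero t ht)).1

/-- If the outer billiard has planar chains, then every characteristic has a planar arc. -/
lemma exists_planar_arc (hK : IsSmoothBody K) (hj : ∀ x, j (j x) = -x)
    (hpl : HasPlanarChains j K) {γ : ℝ → E} (hγ : IsFlowLine j K γ) :
    ∃ a b, a < b ∧ ∃ S : Submodule ℝ E, Module.finrank ℝ S = 2 ∧ ∀ t ∈ Icc a b, deriv γ t ∈ S := by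
  obtain ⟨a, ha⟩ := hK.exists_curved_time hj hγ
  have hc : Continuous fun t => inner ℝ (normal K (γ t)) (deriv (deriv γ) t) :=
    (hK.continuousOn_normal.comp_continuous hγ.continuous hγ.mem).inner
      (hK.contDiff_deriv_deriv hγ 0).continuous
  have hev : ∀ᶠ t in 𝓝 a, inner ℝ (normal K (γ t)) (deriv (deriv γ) t) ≠ 0 :=
    hc.continuousAt.eventually (isOpen_ne.mem_nhds ha)
  obtain ⟨ε, hε, hball⟩ := Metric.mem_nhds_iff.1 hev
  have hsub : ∀ t ∈ Icc a (a + ε / 2), inner ℝ (normal K (γ t)) (deriv (deriv γ) t) ≠ 0 :=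
    fun t ht => hball (by
      rw [mem_ball, Real.dist_eq, abs_lt]
      constructor <;> linarith [ht.1, ht.2])
  refine ⟨a, a + ε / 2, by linarith, _, ?_, hK.deriv_mem_span hγ (fun t ht h0 => ?_) fun t ht => ?_⟩
  · have h0 : deriv (deriv γ) a ≠ 0 := fun h0 => ha (by rw [h0, inner_zero_right])
    have h := finrank_span_eq_card (hK.linearIndependent_deriv hγ h0)
    rw [Matrix.range_cons, Matrix.range_cons, Matrix.range_empty, Set.union_empty,
      Set.singleton_union] at h
    simpa using h
  · exact hsub t ht (by rw [h0, inner_zero_right])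
  · have h := hK.not_linearIndependent_deriv hj hpl (hγ.comp_add t) (by
      rw [deriv_shift, deriv_shift]; simpa using hsub t ht)
    simpa only [deriv_shift, zero_add] using h

end IsSmoothBody

end OuterBilliard

/-! ### Planar bodies: the characteristic goes around the boundary -/

namespace OuterBilliard

/-- Multiplication by `i` as a real linear isometry. -/
noncomputable def mulI : ℂ →ₗᵢ[ℝ] ℂ where
  toLinearMap := LinearMap.mulLeft ℝ Complex.I
  norm_map' z := by simp

lemma mulI_apply (z : ℂ) : mulI z = Complex.I * z := rfl

lemma mulI_mulI (z : ℂ) : mulI (mulI z) = -z := by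
  rw [mulI_apply, mulI_apply, ← mul_assoc, Complex.I_mul_I, neg_one_mul]

lemma complex_inner_eq (z w : ℂ) : inner ℝ z w = z.re * w.re + z.im * w.im := by
  rw [Complex.inner]; simp; ring

variable {M : Set ℂ}

lemma exists_pos_le_inner_normal (hM : IsSmoothBody M) (h0 : 0 ∈ interior M) :
    ∃ r > 0, ∀ x ∈ frontier M, r ≤ inner ℝ (normal M x) x := by
  obtain ⟨r, hr, hball⟩ := Metric.mem_nhds_iff.1 (mem_interior_iff_mem_nhds.1 h0)
  refine ⟨r / 2, half_pos hr, fun x hx => ?_⟩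
  have hmem : (r / 2) • normal M x ∈ M := hball (by
    rw [mem_ball_zero_iff, norm_smul, hM.norm_normal hx, Real.norm_of_nonneg (by positivity)]
    linarith)
  have h := hM.inner_normal_le hx hmem
  rw [inner_sub_right, inner_smul_right, real_inner_self_eq_norm_sq, hM.norm_normal hx] at h
  linarith

/-- The characteristic of a planar body runs through the whole boundary. -/
lemma exists_ge_eq_of_mem_frontier (hM : IsSmoothBody M) (h0 : 0 ∈ interior M) {β : ℝ → ℂ}
    (hβ : IsFlowLine mulI M β) {x : ℂ} (hx : x ∈ frontier M) (t₀ : ℝ) : ∃ t ≥ t₀, β t = x := by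
  obtain ⟨r, hr, hrN⟩ := exists_pos_le_inner_normal hM h0
  have hne : ∀ y ∈ frontier M, y ≠ 0 := fun y hy h => by
    have := hrN y hy
    rw [h, inner_zero_right] at this
    linarith
  obtain ⟨R, hR⟩ := hM.isCompact_frontier.exists_bound_of_continuousOn continuousOn_id
  -- The logarithmic derivative of `β`. Its imaginary part is the angular speed about the origin,
  -- bounded below by a positive constant; its integral `l` is a continuous logarithm of `β / β t₀`.
  set g : ℝ → ℂ := fun t => mulI (normal M (β t)) / β t with hg
  have hgc : Continuous g :=
    (mulI.continuous.comp (hM.continuousOn_normal.comp_continuous hβ.continuous hβ.mem)).div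
      hβ.continuous fun t => hne _ (hβ.mem t)
  have hgim : ∀ t, r / R ^ 2 ≤ (g t).im := fun t => by
    have h1 := hrN _ (hβ.mem t)
    have h2 : ‖β t‖ ≤ R := hR _ (hβ.mem t)
    have h3 : 0 < ‖β t‖ := norm_pos_iff.2 (hne _ (hβ.mem t))
    have h4 : (g t).im = inner ℝ (normal M (β t)) (β t) / ‖β t‖ ^ 2 := by
      rw [hg, complex_inner_eq, ← Complex.normSq_eq_norm_sq]
      simp only [mulI_apply, Complex.div_im, Complex.mul_re, Complex.mul_im, Complex.I_re,
        Complex.I_im]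
      ring
    rw [h4]
    have h5 : 0 ≤ inner ℝ (normal M (β t)) (β t) := hr.le.trans h1
    gcongr
  set l : ℝ → ℂ := fun t => ∫ s in t₀..t, g s with hl
  have hld : ∀ t, HasDerivAt l (g t) t := fun t =>
    intervalIntegral.integral_hasDerivAt_right (hgc.intervalIntegrable _ _)
      (hgc.stronglyMeasurableAtFilter _ _) hgc.continuousAt
  have hl0 : l t₀ = 0 := by simp [hl]
  have hβl : ∀ t, β t = β t₀ * Complex.exp (l t) := fun t => by
    have hd : ∀ s, HasDerivAt (fun s => β s * Complex.exp (-l s)) 0 s := fun s => by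
      have h1 : HasDerivAt (fun s => β s * Complex.exp (-l s)) (mulI (normal M (β s)) *
          Complex.exp (-l s) + β s * (Complex.exp (-l s) * -g s)) s :=
        (hβ.hasDerivAt s).mul ((hld s).neg.cexp)
      have h2 : β s ≠ 0 := hne _ (hβ.mem s)
      have h3 : mulI (normal M (β s)) = g s * β s := by rw [hg]; field_simp
      rw [h3, show g s * β s * Complex.exp (-l s) + β s * (Complex.exp (-l s) * -g s) = 0 by ring]
        at h1
      exact h1
    have h := is_const_of_deriv_eq_zero (fun s => (hd s).differentiableAt)
      (fun s => (hd s).deriv) t t₀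
    simp only [hl0, neg_zero, Complex.exp_zero, mul_one] at h
    rw [← h, mul_assoc, ← Complex.exp_add, neg_add_cancel, Complex.exp_zero, mul_one]
  have hθ : ∀ t, HasDerivAt (fun t => (l t).im) ((g t).im) t := fun t =>
    (Complex.imCLM.hasFDerivAt.comp_hasDerivAt t (hld t))
  have hR0 : 0 < R := (norm_pos_iff.2 (hne _ (hβ.mem t₀))).trans_le (hR _ (hβ.mem t₀))
  have hgrow : ∀ t ≥ t₀, r / R ^ 2 * (t - t₀) ≤ (l t).im := fun t ht => by
    have h := (convex_Icc t₀ t).mul_sub_le_image_sub_of_le_deriv (f := fun t => (l t).im)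
      (C := r / R ^ 2) (fun s _ => (hθ s).continuousAt.continuousWithinAt)
      (fun s _ => (hθ s).differentiableAt.differentiableWithinAt)
      (fun s _ => by rw [(hθ s).deriv]; exact hgim s) t₀ (left_mem_Icc.2 ht) t
      (right_mem_Icc.2 ht) ht
    simpa [hl0] using h
  -- A full turn is added so that the target angle is nonnegative and is reached at some time after
  -- `t₀`.
  set φ : ℝ := Complex.arg (x / β t₀) + 2 * Real.pi with hφ
  have hφ0 : 0 ≤ φ := by
    have := Complex.neg_pi_lt_arg (x / β t₀)
    linarith [Real.pi_pos]
  set T : ℝ := t₀ + φ / (r / R ^ 2) with hT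
  have hTt : t₀ ≤ T := by rw [hT]; have : 0 ≤ φ / (r / R ^ 2) := by positivity
                          linarith
  obtain ⟨t, ht, hφt⟩ : φ ∈ (fun t => (l t).im) '' Icc t₀ T := by
    refine intermediate_value_Icc hTt (fun s _ => (hθ s).continuousAt.continuousWithinAt)
      ⟨by simpa [hl0] using hφ0, ?_⟩
    have h := hgrow T hTt
    have e : r / R ^ 2 * (T - t₀) = φ := by rw [hT]; field_simp; ring
    rwa [e] at h
  refine ⟨t, ht.1, ?_⟩
  have hβ0 : β t₀ ≠ 0 := hne _ (hβ.mem t₀)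
  have hx0 : x ≠ 0 := hne x hx
  obtain ⟨k, hk, hkx⟩ : ∃ k : ℝ, 0 < k ∧ β t = k • x := by
    have h0 : 0 < ‖x / β t₀‖ := norm_pos_iff.2 (div_ne_zero hx0 hβ0)
    refine ⟨Real.exp (l t).re / ‖x / β t₀‖, by positivity, ?_⟩
    have h1 : x / β t₀ = ‖x / β t₀‖ * Complex.exp (φ * Complex.I) := by
      rw [hφ]
      push_cast
      rw [add_mul, Complex.exp_add, Complex.exp_two_pi_mul_I, mul_one,
        Complex.norm_mul_exp_arg_mul_I]
    have h2 : Complex.exp (l t) = Real.exp (l t).re * Complex.exp (φ * Complex.I) := by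
      simp only at hφt
      rw [← hφt, Complex.ofReal_exp, ← Complex.exp_add, Complex.re_add_im]
    have h3 : x = β t₀ * (‖x / β t₀‖ * Complex.exp (φ * Complex.I)) := by
      rw [← h1]; field_simp
    have h4 : (‖x / β t₀‖ : ℂ) ≠ 0 := by
      exact_mod_cast h0.ne'
    rw [hβl t, h2, Complex.real_smul, Complex.ofReal_div]
    generalize (‖x / β t₀‖ : ℂ) = ρ at h3 h4
    generalize (Real.exp (l t).re : ℂ) = e
    field_simp
    rw [h3]
    ring
  -- The two boundary points lie on one ray from an interior point; the supporting lines at both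
  -- leave only `k = 1`.
  have h1 := hM.inner_normal_le hx (hM.frontier_subset (hβ.mem t))
  have h2 := hM.inner_normal_le (hβ.mem t) (hM.frontier_subset hx)
  have h3 := hrN x hx
  have h4 := hrN _ (hβ.mem t)
  have e1 : β t - x = (k - 1) • x := by rw [hkx]; module
  have e2 : x - β t = (k⁻¹ - 1) • β t := by
    rw [hkx, smul_smul, sub_mul, inv_mul_cancel₀ hk.ne']; module
  rw [e1, inner_smul_right] at h1
  rw [e2, inner_smul_right] at h2
  have h5 : k ≤ 1 := by by_contra! h; nlinarith
  have h6 : 1 ≤ k := by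
    by_contra! h
    have := (one_lt_inv₀ hk).2 h
    nlinarith
  rw [hkx, le_antisymm h5 h6, one_smul]

end OuterBilliard

/-! ### Planar bodies: intersections of nearby tangent lines -/

namespace OuterBilliard

variable {M : Set ℂ}

/-- The tangent lines of a planar body at two nearby boundary points intersect, on the forward side
of the first point and the backward side of the second one. -/
lemma exists_tangent_intersection (hM : IsSmoothBody M) {β : ℝ → ℂ} (hβ : IsFlowLine mulI M β)
    (b : ℝ) : ∃ δ > 0, ∃ H S : ℝ → ℝ, ContinuousOn H (Ioo (b - δ) b) ∧
      ∀ t ∈ Ioo (b - δ) (b + δ), t ≠ b →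
        β t - β b = H t • mulI (normal M (β b)) + S t • mulI (normal M (β t)) ∧
        LinearIndependent ℝ ![mulI (normal M (β t)), mulI (normal M (β b))] ∧
        0 < (t - b) * H t ∧ 0 < (t - b) * S t ∧ |H t| ≤ |t - b| := by
  set N : ℝ → ℂ := fun t => normal M (β t) with hN
  have hNc : Continuous N := hM.continuousOn_normal.comp_continuous hβ.continuous hβ.mem
  have hN1 : ∀ t, (N t).re ^ 2 + (N t).im ^ 2 = 1 := fun t => by
    have h : ‖N t‖ ^ 2 = 1 := by rw [hM.norm_normal (hβ.mem t), one_pow]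
    rw [← Complex.normSq_eq_norm_sq, Complex.normSq_apply] at h
    linarith
  -- `D` and `C` are the sine and cosine of the angle from `N b` to `N t`; `H` and `S` below are
  -- given by Cramer's rule with determinant `D`.
  set D : ℝ → ℝ := fun t => (N t).im * (N b).re - (N t).re * (N b).im with hD
  set C : ℝ → ℝ := fun t => (N t).re * (N b).re + (N t).im * (N b).im with hC
  have hDc : Continuous D := by
    have := Complex.continuous_re.comp hNc
    have := Complex.continuous_im.comp hNc
    simp only [Function.comp_def] at *
    fun_prop
  have hCc : Continuous C := by
    have := Complex.continuous_re.comp hNc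
    have := Complex.continuous_im.comp hNc
    simp only [Function.comp_def] at *
    fun_prop
  have hCb : C b = 1 := by rw [← hN1 b, hC]; ring
  have hCpos : ∀ᶠ t in 𝓝 b, 0 < C t :=
    hCc.continuousAt.eventually (lt_mem_nhds (by rw [hCb]; exact one_pos))
  have hslope : ∀ᶠ t in 𝓝 b, t ≠ b →
      0 < (t - b)⁻¹ * inner ℝ (mulI (N b)) (β t - β b) := by
    have hd : HasDerivAt (fun t => inner ℝ (mulI (N b)) (β t)) 1 b := by
      have h := (innerSL ℝ (mulI (N b))).hasFDerivAt.comp_hasDerivAt b (hβ.hasDerivAt b)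
      have e : (innerSL ℝ (mulI (N b))) (mulI (normal M (β b))) = 1 := by
        rw [innerSL_apply_apply, real_inner_self_eq_norm_sq, mulI.norm_map,
          hM.norm_normal (hβ.mem b), one_pow]
      rw [e] at h
      exact h
    have h := (hasDerivAt_iff_tendsto_slope.1 hd).eventually (lt_mem_nhds one_pos)
    rw [eventually_nhdsWithin_iff] at h
    filter_upwards [h] with t ht hne
    have := ht hne
    rwa [slope_def_field, div_eq_inv_mul, ← inner_sub_right] at this
  obtain ⟨δ, hδ, hball⟩ := Metric.mem_nhds_iff.1 (hCpos.and hslope)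
  set H : ℝ → ℝ := fun t => inner ℝ (N t) (β t - β b) / D t with hH
  set S : ℝ → ℝ := fun t => -inner ℝ (N b) (β t - β b) / D t with hS
  have hmain : ∀ t ∈ Ioo (b - δ) (b + δ), t ≠ b → D t ≠ 0 ∧
      β t - β b = H t • mulI (N b) + S t • mulI (N t) ∧
      LinearIndependent ℝ ![mulI (N t), mulI (N b)] ∧
      0 < (t - b) * H t ∧ 0 < (t - b) * S t ∧ |H t| ≤ |t - b| := by
    intro t ht hne
    obtain ⟨hCt, hst⟩ := hball (by
      rw [mem_ball, Real.dist_eq, abs_lt]; constructor <;> linarith [ht.1, ht.2] : t ∈ ball b δ)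
    have hst := hst hne
    have htb : t - b ≠ 0 := sub_ne_zero.2 hne
    have hβne : β t ≠ β b := fun h => by
      rw [h, sub_self, inner_zero_right, mul_zero] at hst
      exact lt_irrefl _ hst
    have i1 : 0 < inner ℝ (N t) (β t - β b) := by
      have := hM.inner_normal_lt (hβ.mem t) (hM.frontier_subset (hβ.mem b)) hβne.symm
      rw [← neg_sub, inner_neg_right] at this
      linarith
    have i2 : 0 < -inner ℝ (N b) (β t - β b) := by
      have := hM.inner_normal_lt (hβ.mem b) (hM.frontier_subset (hβ.mem t)) hβne
      linarith
    have hCD : C t ^ 2 + D t ^ 2 = 1 := by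
      have : C t ^ 2 + D t ^ 2
          = ((N t).re ^ 2 + (N t).im ^ 2) * ((N b).re ^ 2 + (N b).im ^ 2) := by
        simp only [hC, hD]; ring
      rw [this, hN1, hN1, one_mul]
    -- Parallel tangents with `C > 0` would mean equal normals at two distinct boundary points.
    have hD0 : D t ≠ 0 := fun h => by
      have hC1 : C t = 1 := by
        rw [h] at hCD
        nlinarith
      have hsq : ((N t).re - (N b).re) ^ 2 + ((N t).im - (N b).im) ^ 2 = 0 := by
        have : ((N t).re - (N b).re) ^ 2 + ((N t).im - (N b).im) ^ 2
            = ((N t).re ^ 2 + (N t).im ^ 2) + ((N b).re ^ 2 + (N b).im ^ 2) - 2 * C t := by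
          simp only [hC]; ring
        rw [this, hN1, hN1, hC1]; norm_num
      have e : N t = N b := by
        apply Complex.ext <;> nlinarith [sq_nonneg ((N t).re - (N b).re),
          sq_nonneg ((N t).im - (N b).im)]
      rw [e] at i1
      linarith
    have hdec : β t - β b = H t • mulI (N b) + S t • mulI (N t) := by
      simp only [hH, hS, complex_inner_eq]
      apply Complex.ext
      · simp only [mulI_apply, Complex.add_re, Complex.smul_re, Complex.mul_re, Complex.I_re,
          Complex.I_im, smul_eq_mul]
        field_simp
        simp only [hD]; ring
      · simp only [mulI_apply, Complex.add_im, Complex.smul_im, Complex.mul_im, Complex.I_re,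
          Complex.I_im, smul_eq_mul]
        field_simp
        simp only [hD]; ring
    have hproj : inner ℝ (mulI (N b)) (β t - β b) = H t + S t * C t := by
      rw [hdec, inner_add_right, inner_smul_right, inner_smul_right, real_inner_self_eq_norm_sq,
        mulI.norm_map, mulI.inner_map_map, hM.norm_normal (hβ.mem b), complex_inner_eq]
      simp only [hC]; ring
    have hHD : 0 < H t * D t := by rw [hH]; simp only; rwa [div_mul_cancel₀ _ hD0]
    have hSD : 0 < S t * D t := by rw [hS]; simp only; rwa [div_mul_cancel₀ _ hD0]
    have hst' : 0 < (t - b) * (H t + S t * C t) := by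
      rw [← hproj]
      have h1 := mul_pos (sq_pos_of_ne_zero htb) hst
      have e : (t - b) ^ 2 * ((t - b)⁻¹ * inner ℝ (mulI (N b)) (β t - β b))
          = (t - b) * inner ℝ (mulI (N b)) (β t - β b) := by field_simp
      rwa [e] at h1
    -- `H` and `S` both have the sign of `D`, and the displacement along the tangent at `b`, equal
    -- to `H + S C`, has the sign of `t - b`.
    have hsign : 0 < (t - b) * D t := by
      have h1 : 0 < (H t + S t * C t) * D t := by nlinarith [mul_pos hSD hCt]
      rcases lt_or_gt_of_ne hD0 with h | h
      · have h2 : H t + S t * C t < 0 := by by_contra! h3; nlinarith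
        have h3 : t - b < 0 := by by_contra! h3; nlinarith
        exact mul_pos_of_neg_of_neg h3 h
      · have h2 : 0 < H t + S t * C t := by by_contra! h3; nlinarith
        have h3 : 0 < t - b := by by_contra! h3; nlinarith
        exact mul_pos h3 h
    have htD : ∀ x : ℝ, 0 < x * D t → 0 < (t - b) * x := fun x hx => by
      have h1 := mul_pos hsign hx
      have e : (t - b) * D t * (x * D t) = ((t - b) * x) * D t ^ 2 := by ring
      rw [e] at h1
      exact pos_of_mul_pos_left h1 (sq_nonneg _)
    refine ⟨hD0, hdec, ?_, htD _ hHD, htD _ hSD, ?_⟩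
    · rw [LinearIndependent.pair_iff]
      intro x y hxy
      have e1 := congrArg Complex.re hxy
      have e2 := congrArg Complex.im hxy
      simp only [mulI_apply, Complex.add_re, Complex.smul_re, Complex.mul_re, Complex.I_re,
        Complex.I_im, smul_eq_mul, Complex.add_im, Complex.smul_im, Complex.mul_im,
        Complex.zero_re, Complex.zero_im] at e1 e2
      have e3 : x * D t = 0 := by
        simp only [hD]; linear_combination -(N b).re * e1 - (N b).im * e2
      have e4 : y * D t = 0 := by
        simp only [hD]; linear_combination (N t).re * e1 + (N t).im * e2
      exact ⟨(mul_eq_zero.1 e3).resolve_right hD0, (mul_eq_zero.1 e4).resolve_right hD0⟩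
    · have h1 : |H t| ≤ |H t + S t * C t| := by
        have h2 : 0 ≤ H t * (S t * C t) := by
          have h3 := mul_pos hHD hSD
          have e : H t * D t * (S t * D t) = (H t * S t) * D t ^ 2 := by ring
          rw [e] at h3
          have h4 := pos_of_mul_pos_left h3 (sq_nonneg _)
          nlinarith
        rw [← sq_le_sq]
        nlinarith [sq_nonneg (S t * C t)]
      refine h1.trans ?_
      rw [← hproj]
      refine (abs_real_inner_le_norm _ _).trans ?_
      rw [mulI.norm_map, hM.norm_normal (hβ.mem b), one_mul]
      exact hβ.norm_sub_le hM b t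
  refine ⟨δ, hδ, H, S, ?_, fun t ht hne => (hmain t ht hne).2⟩
  refine ContinuousOn.div (by have := hβ.continuous; fun_prop) hDc.continuousOn fun t ht => ?_
  exact (hmain t ⟨ht.1, by linarith [ht.2]⟩ ht.2.ne).1

end OuterBilliard

/-! ### Plane sections and the propagation of tangent points -/

namespace OuterBilliard

variable {E : Type*} [NormedAddCommGroup E] [InnerProductSpace ℝ E]
variable {j : E →ₗᵢ[ℝ] E} {K : Set E} {o : E} {ι : ℂ →ₗᵢ[ℝ] E}

/-- The section of `K` by the plane through `o` parametrized by `ι`. -/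
def planeSection (K : Set E) (o : E) (ι : ℂ →ₗᵢ[ℝ] E) : Set ℂ := {x | o + ι x ∈ K}

/-- The plane through the interior point `o` of `K` parametrized by `ι` is positive for the
symplectic form of `j`. -/
structure IsPlanarFrame (j : E →ₗᵢ[ℝ] E) (K : Set E) (o : E) (ι : ℂ →ₗᵢ[ℝ] E) : Prop where
  mem_interior : o ∈ interior K
  symplectic : ∃ σ : ℝ, 0 < σ ∧ ∀ a b, inner ℝ (j (ι a)) (ι b) = σ * inner ℝ (mulI a) b

/-- The characteristic direction of `K` at the point `x` of the plane is tangent to the plane. -/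
def IsTangentPoint (j : E →ₗᵢ[ℝ] E) (K : Set E) (o : E) (ι : ℂ →ₗᵢ[ℝ] E) (x : ℂ) : Prop :=
  j (normal K (o + ι x)) ∈ range ι

lemma continuous_plane (o : E) (ι : ℂ →ₗᵢ[ℝ] E) : Continuous fun x => o + ι x := by fun_prop

lemma zero_mem_interior_planeSection (ho : o ∈ interior K) :
    (0 : ℂ) ∈ interior (planeSection K o ι) :=
  preimage_interior_subset_interior_preimage (continuous_plane o ι) (by simpa using ho)

lemma mem_frontier_of_planeSection {x : ℂ} (hx : x ∈ frontier (planeSection K o ι)) :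
    o + ι x ∈ frontier K :=
  (continuous_plane o ι).frontier_preimage_subset K hx

variable [FiniteDimensional ℝ E]

lemma inner_adjoint (ι : ℂ →ₗᵢ[ℝ] E) (ν : E) (x : ℂ) :
    inner ℝ (ContinuousLinearMap.adjoint ι.toContinuousLinearMap ν) x = inner ℝ ν (ι x) :=
  ContinuousLinearMap.adjoint_inner_left _ _ _

lemma adjoint_apply_map (ι : ℂ →ₗᵢ[ℝ] E) (x : ℂ) :
    ContinuousLinearMap.adjoint ι.toContinuousLinearMap (ι x) = x := by
  refine ext_inner_right ℝ fun y => ?_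
  rw [inner_adjoint, ι.inner_map_map]

namespace IsSmoothBody

lemma inner_normal_center_neg (hK : IsSmoothBody K) (ho : o ∈ interior K) {x : ℂ}
    (hx : o + ι x ∈ frontier K) : inner ℝ (normal K (o + ι x)) (ι x) > 0 := by
  have h := hK.inner_normal_lt hx (interior_subset ho) fun e => hx.2 (e ▸ ho)
  rw [sub_add_cancel_left, inner_neg_right] at h
  linarith

/-- The plane passes through an interior point, so it is transversal to the boundary: the
differential of a defining function is nonzero on the vector from `o` to the boundary point. -/
lemma planeSection (hK : IsSmoothBody K) (ho : o ∈ interior K) :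
    IsSmoothBody (planeSection K o ι) := by
  have hA : Isometry fun x : ℂ => o + ι x := fun x y => by
    rw [edist_add_left]; exact ι.isometry x y
  refine ⟨hA.isClosedEmbedding.isCompact_preimage hK.compact, ?_,
    ⟨0, zero_mem_interior_planeSection ho⟩, fun z hz => ?_⟩
  · intro x hx y hy hxy a b ha hb hab
    refine preimage_interior_subset_interior_preimage hA.continuous ?_
    have h := hK.strict hx hy (fun e => hxy (hA.injective e)) ha hb hab
    have e : a • (o + ι x) + b • (o + ι y) = (a + b) • o + ι (a • x + b • y) := by
      rw [map_add, map_smul, map_smul]; module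
    rw [e, hab, one_smul] at h
    exact h
  · have hzK := mem_frontier_of_planeSection hz
    obtain ⟨U, hU, hzU, f, hf, hf0, hKU⟩ := hK.smooth _ hzK
    have hd : DifferentiableAt ℝ f (o + ι z) :=
      (hf.contDiffAt (hU.mem_nhds hzU)).differentiableAt (by simp)
    refine ⟨(fun x => o + ι x) ⁻¹' U, hU.preimage hA.continuous, hzU, fun x => f (o + ι x),
      hf.comp (by fun_prop) (fun x hx => hx), fun h0 => ?_, ?_⟩
    · have hn := (hK.isUnitNormal_iff hzK hU hzU hd hf0 hKU _).1 (hK.isUnitNormal_normal hzK)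
      have hpos := hK.inner_normal_center_neg ho hzK
      have hι : HasFDerivAt (fun x : ℂ => o + ι x) ι.toContinuousLinearMap z :=
        ι.toContinuousLinearMap.hasFDerivAt.const_add o
      have hcomp := (hd.hasFDerivAt.comp z hι).fderiv
      have h1 : fderiv ℝ f (o + ι z) (ι z) = 0 := by
        have h2 := congrArg (fun L : ℂ →L[ℝ] ℝ => L z) (hcomp.symm.trans h0)
        exact h2
      have h3 : inner ℝ (gradient f (o + ι z)) (ι z) = 0 := by
        rw [← h1]; simp [gradient]
      rw [hn, inner_smul_left, h3, mul_zero] at hpos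
      exact lt_irrefl _ hpos
    · ext x
      have := Set.ext_iff.1 hKU (o + ι x)
      exact this

/-- For the converse direction, the normal of `K` restricts to a nonzero functional on the plane
because `o` is interior, and this functional supports the section. -/
lemma mem_frontier_planeSection_iff (hK : IsSmoothBody K) (ho : o ∈ interior K) {x : ℂ} :
    x ∈ frontier (OuterBilliard.planeSection K o ι) ↔ o + ι x ∈ frontier K := by
  refine ⟨mem_frontier_of_planeSection, fun hx => ?_⟩
  refine mem_frontier_of_inner_le
    (ν := ContinuousLinearMap.adjoint ι.toContinuousLinearMap (normal K (o + ι x)))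
    (hK.frontier_subset hx) (fun h => ?_) fun y hy => ?_
  · have h1 := hK.inner_normal_center_neg ho hx
    rw [← inner_adjoint, h, inner_zero_left] at h1
    exact lt_irrefl _ h1
  · have h1 := hK.inner_normal_le hx hy
    rw [inner_adjoint, map_sub]
    rwa [add_sub_add_left_eq_sub] at h1

/-- At a tangent point, the characteristic direction of `K` is that of the plane section. -/
lemma map_normal_planeSection (hK : IsSmoothBody K)
    (hf : IsPlanarFrame j K o ι) {x y : ℂ} (hx : o + ι x ∈ frontier K)
    (hy : ι y = j (normal K (o + ι x))) :
    y = mulI (normal (OuterBilliard.planeSection K o ι) x) := by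
  obtain ⟨σ, hσ, hsym⟩ := hf.symplectic
  have hM : IsSmoothBody (OuterBilliard.planeSection K o ι) := hK.planeSection hf.mem_interior
  -- Positivity of `σ` matters: it makes `-mulI y` an outer rather than an inner normal of the
  -- section.
  have hin : ∀ a, inner ℝ (normal K (o + ι x)) (ι a) = σ * inner ℝ (-mulI y) a := fun a => by
    rw [← j.inner_map_map, ← hy, real_inner_comm, hsym, inner_map_left mulI_mulI, inner_neg_left,
      real_inner_comm]
  have hn : IsUnitNormal (OuterBilliard.planeSection K o ι) x (-mulI y) := by
    refine ⟨?_, fun a ha => ?_⟩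
    · rw [norm_neg, mulI.norm_map, ← ι.norm_map, hy, j.norm_map, hK.norm_normal hx]
    · have h1 := hK.inner_normal_le hx ha
      rw [add_sub_add_left_eq_sub, ← map_sub, hin] at h1
      by_contra! h
      nlinarith
  rw [← hM.eq_normal ((hK.mem_frontier_planeSection_iff hf.mem_interior).2 hx) hn, map_neg,
    mulI_mulI, neg_neg]

lemma map_normal_eq (hK : IsSmoothBody K) (hf : IsPlanarFrame j K o ι) {x : ℂ} (hx : o + ι x ∈ frontier K)
    (ht : IsTangentPoint j K o ι x) :
    j (normal K (o + ι x)) = ι (mulI (normal (OuterBilliard.planeSection K o ι) x)) := by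
  obtain ⟨y, hy⟩ := ht
  rw [← hK.map_normal_planeSection hf hx hy, hy]

/-- A planar arc of tangent points extends beyond its end. -/
lemma exists_tangent_extension (hK : IsSmoothBody K) (hj : ∀ x, j (j x) = -x)
    (hpl : HasPlanarChains j K) (hf : IsPlanarFrame j K o ι) {β : ℝ → ℂ}
    (hβ : IsFlowLine mulI (OuterBilliard.planeSection K o ι) β) {a b : ℝ} (hab : a < b)
    (hgood : ∀ t ∈ Ioc a b, IsTangentPoint j K o ι (β t)) :
    ∃ η > 0, ∀ t ∈ Ioo b (b + η), IsTangentPoint j K o ι (β t) := by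
  have hM : IsSmoothBody (OuterBilliard.planeSection K o ι) := hK.planeSection hf.mem_interior
  obtain ⟨δ, hδ, H, S, hHc, hHS⟩ := exists_tangent_intersection hM hβ b
  have hfr : ∀ t, o + ι (β t) ∈ frontier K := fun t => mem_frontier_of_planeSection (hβ.mem t)
  have hv : ∀ t ∈ Ioc a b, j (normal K (o + ι (β t)))
      = ι (mulI (normal (OuterBilliard.planeSection K o ι) (β t))) := fun t ht =>
    hK.map_normal_eq hf (hfr t) (hgood t ht)
  obtain ⟨a', ha'⟩ : ∃ a', max a (b - δ) < a' ∧ a' < b :=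
    exists_between (max_lt hab (by linarith))
  have ha1 : a < a' := (le_max_left _ _).trans_lt ha'.1
  have ha2 : b - δ < a' := (le_max_right _ _).trans_lt ha'.1
  have hHneg : ∀ t ∈ Ioo (b - δ) b, 0 < -H t := fun t ht => by
    have := (hHS t ⟨ht.1, by linarith [ht.2]⟩ ht.2.ne).2.2.1
    have h2 : t - b < 0 := by linarith [ht.2]
    by_contra! h
    nlinarith
  have hHa := hHneg a' ⟨ha2, ha'.2⟩
  refine ⟨min δ (-H a'), lt_min hδ hHa, fun t ht => ?_⟩
  have ht1 : t < b + δ := by linarith [ht.2, min_le_left δ (-H a')]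
  have ht2 : t < b + -H a' := by linarith [ht.2, min_le_right δ (-H a')]
  have htb : 0 < t - b := by linarith [ht.1]
  obtain ⟨hdec, -, hHt, hSt, hHle⟩ := hHS t ⟨by linarith, ht1⟩ (by linarith)
  have hh : 0 < H t := pos_of_mul_pos_right hHt htb.le
  have hs : 0 < S t := pos_of_mul_pos_right hSt htb.le
  rw [abs_of_pos hh, abs_of_pos htb] at hHle
  -- A billiard chain needs equal tangent lengths on both sides of `β b`. The length behind is at
  -- least `H t` near the time `b`, fails to exceed `b - c` at `c`, and varies continuously, so some
  -- earlier good point matches.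
  obtain ⟨t', ht', hHt'⟩ : ∃ t' ∈ Ioo a b, t' ∈ Ioo (b - δ) b ∧ -H t' = H t := by
    obtain ⟨c, hc⟩ : ∃ c, max a' (b - H t) < c ∧ c < b := exists_between (max_lt ha'.2 (by linarith))
    have hc1 : a' < c := (le_max_left _ _).trans_lt hc.1
    have hc2 : b - H t < c := (le_max_right _ _).trans_lt hc.1
    have hcle := (hHS c ⟨by linarith, by linarith [hc.2]⟩ hc.2.ne).2.2.2.2
    rw [abs_of_neg (by linarith [hc.2] : c - b < 0)] at hcle
    have hcH : -H c ≤ H t := by linarith [neg_abs_le (H c)]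
    have hsub : Icc a' c ⊆ Ioo (b - δ) b := fun x hx => ⟨by linarith [hx.1], by linarith [hx.2, hc.2]⟩
    obtain ⟨t', ht', e⟩ := intermediate_value_Icc' (f := fun x => -H x) hc1.le
      ((hHc.mono hsub).neg) ⟨hcH, by linarith⟩
    exact ⟨t', ⟨by linarith [ht'.1], (hsub ht').2⟩, hsub ht', e⟩
  obtain ⟨hdec', hli, -, hSt', -⟩ := hHS t' ⟨hHt'.1.1, by linarith [hHt'.1.2]⟩ hHt'.1.2.ne
  have hs' : 0 < -S t' := by
    have h2 : t' - b < 0 := by linarith [hHt'.1.2]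
    by_contra! h
    nlinarith
  have hvb := hv b ⟨hab, le_rfl⟩
  have hvt := hv t' ⟨ht'.1, ht'.2.le⟩
  obtain ⟨m, hm, s, hs0, hms⟩ := hK.exists_tangent_point hj
    (hK.add_smul_notMem hj (hfr b) hh.ne')
  have hback : β b - β t' = (-S t') • mulI (normal (OuterBilliard.planeSection K o ι) (β t'))
      + H t • mulI (normal (OuterBilliard.planeSection K o ι) (β b)) := by
    rw [← neg_sub, hdec', ← hHt'.2]
    module
  have hdep := hpl _ (hfr t') _ (hfr b) m hm (-S t') (H t) s hs' hh hs0
    (by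
      rw [add_sub_add_left_eq_sub, hvb, hvt, ← map_sub, hback, map_add, map_smul, map_smul])
    (by nth_rw 1 [hms]; abel)
  -- the next tangent direction stays in the plane
  have hmem : j (normal K m) ∈ Submodule.span ℝ
      {j (normal K (o + ι (β t'))), j (normal K (o + ι (β b)))} := by
    by_contra hnot
    refine hdep ?_
    rw [show ![j (normal K (o + ι (β t'))), j (normal K (o + ι (β b))), j (normal K m)]
      = Fin.snoc ![j (normal K (o + ι (β t'))), j (normal K (o + ι (β b)))] (j (normal K m)) from by
        ext k; fin_cases k <;> rfl]
    refine LinearIndependent.finSnoc ?_ ?_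
    · rw [hvb, hvt]
      rw [LinearIndependent.pair_iff] at hli ⊢
      intro c d h
      refine hli c d (ι.injective ?_)
      rw [map_add, map_smul, map_smul, h, map_zero]
    · rw [Set.pair_comm] at hnot
      simpa using hnot
  obtain ⟨c, d, hcd⟩ := Submodule.mem_span_pair.1 hmem
  set y : ℂ := c • mulI (normal (OuterBilliard.planeSection K o ι) (β t'))
    + d • mulI (normal (OuterBilliard.planeSection K o ι) (β b)) with hy
  have hyv : ι y = j (normal K m) := by
    rw [← hcd, hvb, hvt, hy, map_add, map_smul, map_smul]
  set x : ℂ := β b + H t • mulI (normal (OuterBilliard.planeSection K o ι) (β b)) + s • y with hx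
  have hmx : m = o + ι x := by
    have hιx : ι x = ι (β b) + H t • ι (mulI (normal (OuterBilliard.planeSection K o ι) (β b)))
        + s • ι y := by
      rw [hx, map_add, map_add, map_smul, map_smul]
    rw [hιx, hyv, ← hvb, ← add_assoc, ← add_assoc]
    exact hms
  have hxfr : x ∈ frontier (OuterBilliard.planeSection K o ι) :=
    (hK.mem_frontier_planeSection_iff hf.mem_interior).2 (hmx ▸ hm)
  have hyn : y = mulI (normal (OuterBilliard.planeSection K o ι) x) :=
    hK.map_normal_planeSection hf (hmx ▸ hm) (hmx ▸ hyv)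
  -- The next tangent point lies in the plane and is a tangent point of the section seen from the
  -- same vertex, so it is `β t` by uniqueness of the planar step.
  have hxt : x = β t := by
    refine hM.tangent_point_unique mulI_mulI
      (x := β b + H t • mulI (normal (OuterBilliard.planeSection K o ι) (β b)))
      hxfr (hβ.mem t) hs0 hs ?_ ?_
    · rw [← hyn]
    · rw [add_assoc, ← hdec]; abel
  rw [IsTangentPoint, ← hxt, ← hmx]
  exact ⟨y, hyv⟩

/-- If a plane section contains an arc of tangent points, then all its boundary points are tangent
points. -/
lemma isTangentPoint_of_arc (hK : IsSmoothBody K) (hj : ∀ x, j (j x) = -x)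
    (hpl : HasPlanarChains j K) (hf : IsPlanarFrame j K o ι) {β : ℝ → ℂ}
    (hβ : IsFlowLine mulI (OuterBilliard.planeSection K o ι) β) {a b : ℝ} (hab : a < b)
    (hgood : ∀ t ∈ Ioc a b, IsTangentPoint j K o ι (β t)) {x : ℂ}
    (hx : x ∈ frontier (OuterBilliard.planeSection K o ι)) : IsTangentPoint j K o ι x := by
  have hM : IsSmoothBody (OuterBilliard.planeSection K o ι) := hK.planeSection hf.mem_interior
  obtain ⟨T, hT, rfl⟩ :=
    exists_ge_eq_of_mem_frontier hM (zero_mem_interior_planeSection hf.mem_interior) hβ hx b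
  have hcl : IsClosed {t | IsTangentPoint j K o ι (β t)} := by
    have hn : Continuous fun t => normal K (o + ι (β t)) :=
      hK.continuousOn_normal.comp_continuous (f := fun t => o + ι (β t))
        ((continuous_plane o ι).comp hβ.continuous)
        fun t => mem_frontier_of_planeSection (hβ.mem t)
    have hc : Continuous fun t => j (normal K (o + ι (β t))) := j.continuous.comp hn
    exact ι.isometry.isClosedEmbedding.isClosed_range.preimage hc
  by_contra hbad
  -- Continuity argument at the infimum of the bad times: it is good by closedness, and the
  -- extension lemma pushes past it.
  set B : Set ℝ := {t | b ≤ t ∧ ¬ IsTangentPoint j K o ι (β t)} with hB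
  have hBne : B.Nonempty := ⟨T, hT, hbad⟩
  have hBbdd : BddBelow B := ⟨b, fun t ht => ht.1⟩
  set c := sInf B with hc
  have hbc : b ≤ c := le_csInf hBne fun t ht => ht.1
  have hlt : ∀ t, a < t → t < c → IsTangentPoint j K o ι (β t) := fun t ht htc => by
    rcases le_or_gt t b with h | h
    · exact hgood t ⟨ht, h⟩
    · by_contra hn
      exact absurd (csInf_le hBbdd ⟨h.le, hn⟩) (not_le.2 htc)
  have hac : a < c := hab.trans_le hbc
  have hcgood : c ∈ {t | IsTangentPoint j K o ι (β t)} := by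
    refine closure_minimal (s := Ioo a c) (fun t ht => hlt t ht.1 ht.2) hcl ?_
    rw [closure_Ioo hac.ne]
    exact right_mem_Icc.2 hac.le
  obtain ⟨η, hη, hext⟩ := hK.exists_tangent_extension hj hpl hf hβ hac fun t ht =>
    ht.2.lt_or_eq.elim (hlt t ht.1) fun e => e ▸ hcgood
  obtain ⟨t, ht, htc⟩ := exists_lt_of_csInf_lt hBne (by linarith : sInf B < c + η)
  refine ht.2 ?_
  rcases lt_trichotomy t c with h | h | h
  · exact hlt t (hab.trans_le ht.1) h
  · exact h ▸ hcgood
  · exact hext t ⟨h, htc⟩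

end IsSmoothBody

end OuterBilliard

/-! ### Characteristics of the body inside plane sections -/

namespace OuterBilliard

variable {E : Type*} [NormedAddCommGroup E] [InnerProductSpace ℝ E]
variable {j : E →ₗᵢ[ℝ] E} {K : Set E} {o : E} {ι : ℂ →ₗᵢ[ℝ] E}

/-- The form `⟪j ·, ·⟫` is alternating, and on a plane such forms are multiples of the area form. -/
lemma inner_map_plane (hj : ∀ x, j (j x) = -x) (ι : ℂ →ₗᵢ[ℝ] E) (a b : ℂ) :
    inner ℝ (j (ι a)) (ι b) = inner ℝ (j (ι 1)) (ι Complex.I) * inner ℝ (mulI a) b := by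
  have hdec : ∀ z : ℂ, ι z = z.re • ι 1 + z.im • ι Complex.I := fun z => by
    rw [← map_smul, ← map_smul, ← map_add]
    congr 1
    apply Complex.ext <;> simp
  have h1 : inner ℝ (j (ι Complex.I)) (ι 1) = -inner ℝ (j (ι 1)) (ι Complex.I) := by
    rw [inner_map_left hj, real_inner_comm]
  rw [hdec a, hdec b, complex_inner_eq, mulI_apply]
  simp only [map_add, map_smul, inner_add_left, inner_add_right, inner_smul_left, inner_smul_right,
    inner_map_self hj, h1, Complex.mul_re, Complex.mul_im, Complex.I_re, Complex.I_im, conj_trivial]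
  ring

/-- The form is a nonzero multiple of the area form on `S`; if the sign is wrong, complex
conjugation reverses the orientation. -/
lemma exists_symplectic_parametrization (hj : ∀ x, j (j x) = -x) {S : Submodule ℝ E}
    (hS : Module.finrank ℝ S = 2) {a b : E} (ha : a ∈ S) (hb : b ∈ S)
    (hab : inner ℝ (j a) b ≠ 0) :
    ∃ ι : ℂ →ₗᵢ[ℝ] E, range ι = S ∧
      ∃ σ : ℝ, 0 < σ ∧ ∀ a b, inner ℝ (j (ι a)) (ι b) = σ * inner ℝ (mulI a) b := by
  have : FiniteDimensional ℝ S := Module.finite_of_finrank_pos (by omega)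
  let e : ℂ ≃ₗᵢ[ℝ] S := Complex.orthonormalBasisOneI.equiv
    ((stdOrthonormalBasis ℝ S).reindex (finCongr hS)) (Equiv.refl _)
  have key : ∀ e : ℂ ≃ₗᵢ[ℝ] S, range (S.subtypeₗᵢ.comp e.toLinearIsometry) = S := fun e => by
    ext x
    constructor
    · rintro ⟨y, rfl⟩
      exact (e y).2
    · intro hx
      exact ⟨e.symm ⟨x, hx⟩, by simp⟩
  set ι₀ := S.subtypeₗᵢ.comp e.toLinearIsometry with hι₀
  have hσ : inner ℝ (j (ι₀ 1)) (ι₀ Complex.I) ≠ 0 := by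
    intro h
    obtain ⟨x, rfl⟩ : a ∈ range ι₀ := (key e).symm ▸ ha
    obtain ⟨y, rfl⟩ : b ∈ range ι₀ := (key e).symm ▸ hb
    rw [inner_map_plane hj, h, zero_mul] at hab
    exact hab rfl
  rcases hσ.lt_or_gt with h | h
  · refine ⟨S.subtypeₗᵢ.comp (Complex.conjLIE.trans e).toLinearIsometry, key _, _, ?_,
      inner_map_plane hj _⟩
    have h1 : (S.subtypeₗᵢ.comp (Complex.conjLIE.trans e).toLinearIsometry) 1 = ι₀ 1 := by
      simp [hι₀]
    have h2 : (S.subtypeₗᵢ.comp (Complex.conjLIE.trans e).toLinearIsometry) Complex.I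
        = -ι₀ Complex.I := by
      simp [hι₀]
    rw [h1, h2, inner_neg_right]
    linarith
  · exact ⟨ι₀, key e, _, h, inner_map_plane hj _⟩

/-- A curve whose velocity lies in a subspace moves inside a translate of this subspace. -/
lemma sub_mem_of_deriv_mem [FiniteDimensional ℝ E] {S : Submodule ℝ E} {γ γ' : ℝ → E} {a b : ℝ}
    (hγ : ∀ t, HasDerivAt γ (γ' t) t) (hd : ∀ t ∈ Icc a b, γ' t ∈ S) {t : ℝ} (ht : t ∈ Icc a b) :
    γ t - γ a ∈ S := by
  rw [← S.orthogonal_orthogonal, Submodule.mem_orthogonal]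
  intro w hw
  have h : ∀ t, HasDerivAt (fun t => inner ℝ w (γ t)) (inner ℝ w (γ' t)) t := fun t => by
    simpa using (hasDerivAt_const t w).inner ℝ (hγ t)
  rw [inner_sub_right, sub_eq_zero]
  refine constant_of_has_deriv_right_zero (f := fun t => inner ℝ w (γ t))
    (fun t _ => (h t).continuousAt.continuousWithinAt) (fun t ht => ?_) t ht
  have h0 : inner ℝ w (γ' t) = 0 := by
    rw [real_inner_comm]
    exact (Submodule.mem_orthogonal _ _).1 hw _ (hd t (Ico_subset_Icc_self ht))
  exact (h0 ▸ h t).hasDerivWithinAt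

/-- The velocity of a curve inside a translate of a subspace lies in this subspace. -/
lemma deriv_mem_of_sub_mem [FiniteDimensional ℝ E] {S : Submodule ℝ E} {γ : ℝ → E} {γ' o : E}
    {t : ℝ} (hγ : HasDerivAt γ γ' t) (h : ∀ t, γ t - o ∈ S) : γ' ∈ S := by
  rw [← S.orthogonal_orthogonal, Submodule.mem_orthogonal]
  intro w hw
  have h1 : HasDerivAt (fun t => inner ℝ w (γ t)) (inner ℝ w γ') t := by
    simpa using (hasDerivAt_const t w).inner ℝ hγ
  have h2 : (fun t => inner ℝ w (γ t)) = fun _ => inner ℝ w o := funext fun s => by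
    rw [← sub_eq_zero, ← inner_sub_right, real_inner_comm]
    exact (Submodule.mem_orthogonal _ _).1 hw _ (h s)
  rw [h2] at h1
  exact h1.unique (hasDerivAt_const t _)

variable [FiniteDimensional ℝ E]

namespace IsSmoothBody

/-- A planar arc of a flow line lies in a positive plane through an interior point. -/
lemma exists_isPlanarFrame (hK : IsSmoothBody K) (hj : ∀ x, j (j x) = -x) {γ : ℝ → E}
    (hγ : IsFlowLine j K γ) {S : Submodule ℝ E} (hS : Module.finrank ℝ S = 2) {a b : ℝ}
    (hab : a < b) (hd : ∀ t ∈ Icc a b, j (normal K (γ t)) ∈ S) :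
    ∃ (o : E) (ι : ℂ →ₗᵢ[ℝ] E), IsPlanarFrame j K o ι ∧ range ι = S ∧
      ∀ t ∈ Icc a b, ∃ x, γ t = o + ι x := by
  have hne : ∀ᶠ t in 𝓝[>] a, γ t ≠ γ a :=
    (((hγ.hasDerivAt a).eventually_ne (by
      rw [Ne, map_eq_zero_iff j j.injective]; exact hK.normal_ne_zero (hγ.mem a))).filter_mono
      (nhdsWithin_mono _ fun t (ht : a < t) => ht.ne'))
  obtain ⟨t, htne, hat, htb⟩ := (hne.and (Ioo_mem_nhdsGT hab)).exists
  have hSγ : ∀ t ∈ Icc a b, γ t - γ a ∈ S := fun t ht => sub_mem_of_deriv_mem hγ.hasDerivAt hd ht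
  set o : E := (1 / 2 : ℝ) • γ a + (1 / 2 : ℝ) • γ t with ho
  -- The midpoint of a chord of the arc is interior by strict convexity. The vector from `γ a` to it
  -- pairs nontrivially with the tangent at `γ a`, since `j` turns this pairing into the supporting
  -- inequality.
  have hoint : o ∈ interior K := hK.strict (hK.frontier_subset (hγ.mem a))
    (hK.frontier_subset (hγ.mem t)) htne.symm (by norm_num) (by norm_num) (by norm_num)
  have hoS : o - γ a ∈ S := by
    have : o - γ a = (1 / 2 : ℝ) • (γ t - γ a) := by rw [ho]; module
    rw [this]
    exact S.smul_mem _ (hSγ t ⟨hat.le, htb.le⟩)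
  obtain ⟨ι, hι, hsym⟩ := exists_symplectic_parametrization hj hS hoS (hd a ⟨le_rfl, hab.le⟩) (by
    rw [j.inner_map_map, real_inner_comm]
    exact (hK.inner_normal_lt (hγ.mem a) (interior_subset hoint)
      fun e => (hγ.mem a).2 (e ▸ hoint)).ne)
  refine ⟨o, ι, ⟨hoint, hsym⟩, hι, fun s hs => ?_⟩
  have : γ s - o ∈ S := by
    rw [← sub_sub_sub_cancel_right _ _ (γ a)]
    exact S.sub_mem (hSγ s hs) hoS
  obtain ⟨x, hx⟩ : γ s - o ∈ range ι := hι.symm ▸ this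
  exact ⟨x, by rw [hx, add_sub_cancel]⟩

/-- A planar arc of a flow line is an arc of a flow line of the plane section. -/
lemma eq_of_planar_arc (hK : IsSmoothBody K) (hf : IsPlanarFrame j K o ι) {γ : ℝ → E}
    (hγ : IsFlowLine j K γ) {β : ℝ → ℂ} (hβ : IsFlowLine mulI (OuterBilliard.planeSection K o ι) β)
    {a b : ℝ} (hplane : ∀ t ∈ Icc a b, ∃ x, γ t = o + ι x)
    (hd : ∀ t ∈ Icc a b, j (normal K (γ t)) ∈ range ι) (ha : γ a = o + ι (β a)) :
    ∀ t ∈ Icc a b, γ t = o + ι (β t) := by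
  have hM : IsSmoothBody (OuterBilliard.planeSection K o ι) := hK.planeSection hf.mem_interior
  set A := ContinuousLinearMap.adjoint ι.toContinuousLinearMap with hA
  set δ : ℝ → ℂ := fun t => A (γ t - o) with hδ
  have hδγ : ∀ t ∈ Icc a b, γ t = o + ι (δ t) := fun t ht => by
    obtain ⟨x, hx⟩ := hplane t ht
    rw [hδ]
    simp only [hx, add_sub_cancel_left]
    rw [hA, adjoint_apply_map]
  have hδd : ∀ t, HasDerivAt δ (A (j (normal K (γ t)))) t := fun t =>
    A.hasFDerivAt.comp_hasDerivAt t ((hγ.hasDerivAt t).sub_const o)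
  have hv : ∀ t ∈ Icc a b,
      A (j (normal K (γ t))) = mulI (normal (OuterBilliard.planeSection K o ι) (δ t)) := by
    intro t ht
    obtain ⟨y, hy⟩ := hd t ht
    rw [← hy, hA, adjoint_apply_map]
    have hg := hδγ t ht
    exact hK.map_normal_planeSection hf (hg ▸ hγ.mem t) (by rw [hy, ← hg])
  obtain ⟨Λ, hΛ⟩ := hM.lipschitzOnWith_map_normal mulI
  have h := ODE_solution_unique_of_mem_Icc_right (v := fun _ x =>
      mulI (normal (OuterBilliard.planeSection K o ι) x))
    (s := fun _ => frontier (OuterBilliard.planeSection K o ι)) (K := Λ) (f := δ) (g := β)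
    (a := a) (b := b) (fun _ _ => hΛ)
    (fun t _ => (hδd t).continuousAt.continuousWithinAt)
    (fun t ht => hv t (Ico_subset_Icc_self ht) ▸ (hδd t).hasDerivWithinAt)
    (fun t ht => (hK.mem_frontier_planeSection_iff hf.mem_interior).2
      (hδγ t (Ico_subset_Icc_self ht) ▸ hγ.mem t))
    hβ.continuous.continuousOn (fun t _ => (hβ.hasDerivAt t).hasDerivWithinAt)
    (fun t _ => hβ.mem t) (by rw [hδ]; simp only [ha, add_sub_cancel_left]; rw [hA, adjoint_apply_map])
  intro t ht
  rw [hδγ t ht, h ht]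

/-- If all boundary points of a plane section are tangent points, then the flow lines of `K`
through these points stay in the plane. -/
lemma exists_eq_of_isTangentPoint (hK : IsSmoothBody K) (hf : IsPlanarFrame j K o ι)
    (ht : ∀ x ∈ frontier (OuterBilliard.planeSection K o ι), IsTangentPoint j K o ι x) {γ : ℝ → E}
    (hγ : IsFlowLine j K γ) {β : ℝ → ℂ} (hβ : IsFlowLine mulI (OuterBilliard.planeSection K o ι) β)
    {a : ℝ} (ha : γ a = o + ι (β a)) : γ = fun t => o + ι (β t) := by
  refine hK.isFlowLine_unique hγ ⟨fun t => mem_frontier_of_planeSection (hβ.mem t), fun t => ?_⟩ ha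
  rw [hK.map_normal_eq hf (mem_frontier_of_planeSection (hβ.mem t)) (ht _ (hβ.mem t))]
  exact (ι.toContinuousLinearMap.hasFDerivAt.comp_hasDerivAt t (hβ.hasDerivAt t)).const_add o

/-- If three consecutive tangents of billiard trajectories are always linearly dependent, then the
flow lines are planar. -/
lemma exists_plane_of_isFlowLine (hK : IsSmoothBody K) (hj : ∀ x, j (j x) = -x)
    (hpl : HasPlanarChains j K) {γ : ℝ → E} (hγ : IsFlowLine j K γ) :
    ∃ (o : E) (S : Submodule ℝ E), Module.finrank ℝ S = 2 ∧ ∀ t, γ t - o ∈ S := by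
  obtain ⟨a, b, hab, S, hS, hd⟩ := hK.exists_planar_arc hj hpl hγ
  rw [hγ.deriv] at hd
  obtain ⟨o, ι, hf, hι, hplane⟩ := hK.exists_isPlanarFrame hj hγ hS hab hd
  have hM : IsSmoothBody (OuterBilliard.planeSection K o ι) := hK.planeSection hf.mem_interior
  obtain ⟨x, hx⟩ := hplane a ⟨le_rfl, hab.le⟩
  obtain ⟨β, hβ, rfl⟩ := hM.exists_isFlowLine mulI_mulI
    ((hK.mem_frontier_planeSection_iff hf.mem_interior).2 (hx ▸ hγ.mem a)) a
  have hd' : ∀ t ∈ Icc a b, j (normal K (γ t)) ∈ range ι := fun t ht => hι.symm ▸ hd t ht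
  have harc := hK.eq_of_planar_arc hf hγ hβ hplane hd' hx
  have ht := fun x hx => hK.isTangentPoint_of_arc hj hpl hf hβ hab (fun t ht => by
    rw [IsTangentPoint, ← harc t (Ioc_subset_Icc_self ht)]
    exact hd' t (Ioc_subset_Icc_self ht)) (x := x) hx
  have h := hK.exists_eq_of_isTangentPoint hf ht hγ hβ hx
  refine ⟨o, S, hS, fun t => ?_⟩
  have h1 : γ t - o ∈ range ι := ⟨β t, by rw [h]; simp⟩
  rwa [hι] at h1

/-- A planar flow line lies in a plane all of whose boundary points are tangent points. -/
lemma exists_frame_of_planar (hK : IsSmoothBody K) (hj : ∀ x, j (j x) = -x) {γ : ℝ → E}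
    (hγ : IsFlowLine j K γ) {c : E} {S : Submodule ℝ E} (hS : Module.finrank ℝ S = 2)
    (hγS : ∀ t, γ t - c ∈ S) :
    ∃ (o : E) (ι : ℂ →ₗᵢ[ℝ] E), IsPlanarFrame j K o ι ∧ range ι = S ∧ (∃ x, γ 0 = o + ι x) ∧
      ∀ x ∈ frontier (OuterBilliard.planeSection K o ι), IsTangentPoint j K o ι x := by
  have hd : ∀ t, j (normal K (γ t)) ∈ S := fun t => deriv_mem_of_sub_mem (hγ.hasDerivAt t) hγS
  obtain ⟨o, ι, hf, hι, hplane⟩ :=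
    hK.exists_isPlanarFrame hj hγ hS zero_lt_one fun t _ => hd t
  obtain ⟨x₀, hx₀⟩ := hplane 0 ⟨le_rfl, zero_le_one⟩
  refine ⟨o, ι, hf, hι, ⟨x₀, hx₀⟩, fun x hx => ?_⟩
  have hM : IsSmoothBody (OuterBilliard.planeSection K o ι) := hK.planeSection hf.mem_interior
  obtain ⟨β, hβ, rfl⟩ := hM.exists_isFlowLine mulI_mulI
    ((hK.mem_frontier_planeSection_iff hf.mem_interior).2 (hx₀ ▸ hγ.mem 0)) 0
  obtain ⟨T, hT, rfl⟩ :=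
    exists_ge_eq_of_mem_frontier hM (zero_mem_interior_planeSection hf.mem_interior) hβ hx 0
  have hplane' : ∀ t ∈ Icc 0 T, ∃ x, γ t = o + ι x := fun t ht => by
    have h1 : γ t - γ 0 ∈ S := by
      rw [← sub_sub_sub_cancel_right _ _ c]
      exact S.sub_mem (hγS t) (hγS 0)
    obtain ⟨y, hy⟩ : γ t - γ 0 ∈ range ι := hι.symm ▸ h1
    exact ⟨β 0 + y, by rw [map_add, ← add_assoc, ← hx₀, hy, add_sub_cancel]⟩
  have hd' : ∀ t ∈ Icc 0 T, j (normal K (γ t)) ∈ range ι := fun t _ => hι.symm ▸ hd t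
  have h := hK.eq_of_planar_arc hf hγ hβ hplane' hd' hx₀ T ⟨hT, le_rfl⟩
  rw [IsTangentPoint, ← h]
  exact hd' T ⟨hT, le_rfl⟩

/-- The tangent point of a point of a plane of tangent points lies in this plane. -/
lemma tangent_point_mem_plane (hK : IsSmoothBody K) (hj : ∀ x, j (j x) = -x)
    (hf : IsPlanarFrame j K o ι)
    (ht : ∀ x ∈ frontier (OuterBilliard.planeSection K o ι), IsTangentPoint j K o ι x)
    {x : ℂ} {z : E} {s : ℝ} (hz : z ∈ frontier K) (hs : 0 < s) (hx : o + ι x ∉ K)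
    (hzx : z = o + ι x + s • j (normal K z)) : ∃ y, z = o + ι y := by
  have hM : IsSmoothBody (OuterBilliard.planeSection K o ι) := hK.planeSection hf.mem_interior
  -- The tangent point of the section is also one for `K`, since all boundary points of the section
  -- are tangent points; uniqueness identifies it with `z`.
  obtain ⟨w, hw, r, hr, hwr⟩ := hM.exists_tangent_point mulI_mulI (x := x) hx
  have hwK := mem_frontier_of_planeSection hw
  refine ⟨w, hK.tangent_point_unique hj hz hwK hs hr hzx ?_⟩
  rw [hK.map_normal_eq hf hwK (ht w hw), add_assoc, ← map_smul, ← map_add, ← hwr]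

end IsSmoothBody

end OuterBilliard

/-! ### Billiard trajectories and reparametrized characteristics -/

namespace OuterBilliard

section Trajectory

variable {E : Type*} [NormedAddCommGroup E] [InnerProductSpace ℝ E]
variable {j : E →ₗᵢ[ℝ] E} {K : Set E}

/-- One step of the outer billiard, described through the tangent point `z`. -/
def IsTangentStep (j : E →ₗᵢ[ℝ] E) (K : Set E) (x y : E) : Prop :=
  x ∉ K ∧ ∃ z ∈ frontier K, ∃ s : ℝ, 0 < s ∧ z = x + s • j (normal K z) ∧
    y = z + s • j (normal K z)

lemma not_linearIndependent_of_mem {S : Submodule ℝ E} (hS : Module.finrank ℝ S = 2) {a b c : E}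
    (ha : a ∈ S) (hb : b ∈ S) (hc : c ∈ S) : ¬ LinearIndependent ℝ ![a, b, c] := by
  intro h
  have : FiniteDimensional ℝ S := Module.finite_of_finrank_pos (by omega)
  have e : ![a, b, c] = S.subtype ∘ ![⟨a, ha⟩, ⟨b, hb⟩, ⟨c, hc⟩] := by
    ext k; fin_cases k <;> rfl
  rw [e] at h
  have := h.of_comp.fintype_card_le_finrank
  rw [hS] at this
  simp at this

variable [FiniteDimensional ℝ E]

namespace IsSmoothBody

lemma isTangentStep_unique (hK : IsSmoothBody K) (hj : ∀ x, j (j x) = -x) {x y y' : E}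
    (h : IsTangentStep j K x y) (h' : IsTangentStep j K x y') : y = y' := by
  obtain ⟨-, z, hz, s, hs, hzx, rfl⟩ := h
  obtain ⟨-, z', hz', s', hs', hzx', rfl⟩ := h'
  obtain rfl := hK.tangent_point_unique hj hz hz' hs hs' hzx hzx'
  have h1 : s • j (normal K z) = s' • j (normal K z) := add_left_cancel (hzx.symm.trans hzx')
  rw [h1]

/-- Every point outside `K` is the initial point of a trajectory. -/
lemma exists_trajectory (hK : IsSmoothBody K) (hj : ∀ x, j (j x) = -x) {x : E} (hx : x ∉ K) :
    ∃ u : ℕ → E, u 0 = x ∧ ∀ k, IsTangentStep j K (u k) (u (k + 1)) := by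
  have hstep : ∀ x : {x // x ∉ K}, ∃ y : {y // y ∉ K}, IsTangentStep j K x y := fun x => by
    obtain ⟨z, hz, s, hs, hzx⟩ := hK.exists_tangent_point hj x.2
    exact ⟨⟨_, hK.add_smul_notMem hj hz hs.ne'⟩, x.2, z, hz, s, hs, hzx, rfl⟩
  choose T hT using hstep
  refine ⟨fun k => T^[k] ⟨x, hx⟩, rfl, fun k => ?_⟩
  simp only [Function.iterate_succ_apply']
  exact hT _

/-- A chain with matching lengths is three steps of a trajectory, which continues indefinitely; its
successive differences are positive multiples of the tangent directions. -/
lemma hasPlanarChains (hK : IsSmoothBody K) (hj : ∀ x, j (j x) = -x)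
    (h : ∀ u : ℕ → E, (∀ k, IsTangentStep j K (u k) (u (k + 1))) →
      ∃ S : Submodule ℝ E, Module.finrank ℝ S = 2 ∧ ∀ k, u (k + 1) - u k ∈ S) :
    HasPlanarChains j K := by
  intro a ha b hb c hc r s t hr hs ht hab hbc
  have h01 : IsTangentStep j K (a + (-r) • j (normal K a)) (a + r • j (normal K a)) :=
    ⟨hK.add_smul_notMem hj ha (neg_ne_zero.2 hr.ne'), a, ha, r, hr, by module, rfl⟩
  have h12 : IsTangentStep j K (a + r • j (normal K a)) (b + s • j (normal K b)) :=
    ⟨hK.add_smul_notMem hj ha hr.ne', b, hb, s, hs, by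
      rw [add_assoc, ← hab, add_sub_cancel], rfl⟩
  have h23 : IsTangentStep j K (b + s • j (normal K b)) (c + t • j (normal K c)) :=
    ⟨hK.add_smul_notMem hj hb hs.ne', c, hc, t, ht, by
      rw [add_assoc, ← hbc, add_sub_cancel], rfl⟩
  obtain ⟨u, hu0, hu⟩ := hK.exists_trajectory hj h01.1
  have hu1 : u 1 = a + r • j (normal K a) := hK.isTangentStep_unique hj (hu0 ▸ hu 0) h01
  have hu2 : u 2 = b + s • j (normal K b) := hK.isTangentStep_unique hj (hu1 ▸ hu 1) h12
  have hu3 : u 3 = c + t • j (normal K c) := hK.isTangentStep_unique hj (hu2 ▸ hu 2) h23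
  obtain ⟨S, hS, huS⟩ := h u hu
  have key : ∀ {v : E} {r : ℝ}, 0 < r → ∀ k, u (k + 1) - u k = (2 * r) • v → v ∈ S :=
    fun {v r} hr k e => by
      have := huS k
      rw [e] at this
      exact (S.smul_mem_iff (by positivity)).1 this
  refine not_linearIndependent_of_mem hS ?_ ?_ ?_
  · refine key hr 0 ?_
    rw [hu0, zero_add, hu1]; module
  · refine key hs 1 ?_
    rw [hu2, hu1, add_sub_add_comm, hab]
    module
  · refine key ht 2 ?_
    rw [hu3, hu2, add_sub_add_comm, hbc]
    module

/-- A curve along the characteristic directions runs through a flow line. -/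
lemma exists_range_subset_flowLine (hK : IsSmoothBody K) (hj : ∀ x, j (j x) = -x) {Γ : ℝ → E}
    (hΓ : ContDiff ℝ 1 Γ) (hmem : ∀ t, Γ t ∈ frontier K)
    (hd : ∀ t, deriv Γ t ∈ Submodule.span ℝ {j (normal K (Γ t))}) :
    ∃ γ, IsFlowLine j K γ ∧ range Γ ⊆ range γ := by
  have hnc : Continuous fun t => j (normal K (Γ t)) :=
    j.continuous.comp (hK.continuousOn_normal.comp_continuous hΓ.continuous hmem)
  set c : ℝ → ℝ := fun t => inner ℝ (deriv Γ t) (j (normal K (Γ t))) with hc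
  have hcc : Continuous c := (hΓ.continuous_deriv le_rfl).inner hnc
  have hΓd : ∀ t, HasDerivAt Γ (c t • j (normal K (Γ t))) t := fun t => by
    obtain ⟨r, hr⟩ := Submodule.mem_span_singleton.1 (hd t)
    have : c t = r := by
      rw [hc]
      simp only
      rw [← hr, inner_smul_left, j.inner_map_map, real_inner_self_eq_norm_sq,
        hK.norm_normal (hmem t)]
      simp
    rw [this, hr]
    exact (hΓ.differentiable one_ne_zero t).hasDerivAt
  obtain ⟨γ, hγ, hγ0⟩ := hK.exists_isFlowLine hj (hmem 0) 0
  refine ⟨γ, hγ, ?_⟩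
  rintro _ ⟨T, rfl⟩
  -- Running the flow line at the signed speed `c` solves the same nonautonomous equation as `Γ`, so
  -- the two agree.
  refine ⟨∫ t in (0 : ℝ)..T, c t, ?_⟩
  obtain ⟨Λ, hΛ⟩ := hK.lipschitzOnWith_map_normal j
  obtain ⟨C, hC⟩ := (isCompact_Icc (a := -(|T| + 1)) (b := |T| + 1)).exists_bound_of_continuousOn
    hcc.continuousOn
  have h0 : (0 : ℝ) ∈ Ioo (-(|T| + 1)) (|T| + 1) := by
    constructor <;> linarith [abs_nonneg T]
  have hT : T ∈ Ioo (-(|T| + 1)) (|T| + 1) := by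
    constructor <;> linarith [le_abs_self T, neg_abs_le T]
  refine ODE_solution_unique_of_mem_Ioo (v := fun t x => c t • j (normal K x))
    (s := fun _ => frontier K) (K := C.toNNReal * Λ) (t₀ := 0)
    (f := fun t => γ (∫ s in (0 : ℝ)..t, c s)) (g := Γ) (fun t ht => ?_) h0
    (fun t _ => ⟨?_, hγ.mem _⟩) (fun t _ => ⟨hΓd t, hmem t⟩) (by simp [hγ0]) hT
  · refine LipschitzOnWith.of_dist_le_mul fun x hx y hy => ?_
    rw [dist_smul₀, NNReal.coe_mul, mul_assoc]
    exact mul_le_mul ((hC t (Ioo_subset_Icc_self ht)).trans (Real.le_coe_toNNReal C))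
      (hΛ.dist_le_mul x hx y hy) dist_nonneg NNReal.zero_le_coe
  · exact (hγ.hasDerivAt _).scomp t
      (intervalIntegral.integral_hasDerivAt_right (hcc.intervalIntegrable _ _)
        (hcc.stronglyMeasurableAtFilter _ _) hcc.continuousAt)

/-- If the flow lines are planar, then so are the trajectories. -/
lemma exists_plane_of_trajectory (hK : IsSmoothBody K) (hj : ∀ x, j (j x) = -x)
    (h : ∀ γ : ℝ → E, IsFlowLine j K γ →
      ∃ (c : E) (S : Submodule ℝ E), Module.finrank ℝ S = 2 ∧ ∀ t, γ t - c ∈ S)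
    {u : ℕ → E} (hu : ∀ k, IsTangentStep j K (u k) (u (k + 1))) :
    ∃ (o : E) (S : Submodule ℝ E), Module.finrank ℝ S = 2 ∧ ∀ k, u k - o ∈ S := by
  obtain ⟨-, z, hz, s, hs, hzu, -⟩ := hu 0
  obtain ⟨γ, hγ, rfl⟩ := hK.exists_isFlowLine hj hz 0
  obtain ⟨c, S, hS, hγS⟩ := h γ hγ
  obtain ⟨o, ι, hf, hι, ⟨x₀, hx₀⟩, ht⟩ := hK.exists_frame_of_planar hj hγ hS hγS
  refine ⟨o, S, hS, fun k => ?_⟩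
  have hmem : ∃ x, u k = o + ι x := by
    induction k with
    | zero =>
      rw [hx₀] at hz hzu
      rw [hK.map_normal_eq hf hz
        (ht _ ((hK.mem_frontier_planeSection_iff hf.mem_interior).2 hz))] at hzu
      refine ⟨x₀ - s • mulI (normal (OuterBilliard.planeSection K o ι) x₀), ?_⟩
      rw [map_sub, map_smul, ← add_sub_assoc]
      exact eq_sub_of_add_eq hzu.symm
    | succ k ih =>
      obtain ⟨x, hx⟩ := ih
      obtain ⟨hxK, w, hw, r, hr, hwx, hy⟩ := hu k
      rw [hx] at hxK hwx
      obtain ⟨y, rfl⟩ := hK.tangent_point_mem_plane hj hf ht hw hr hxK hwx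
      refine ⟨y + (y - x), ?_⟩
      rw [hy, map_add, map_sub, ← add_assoc, ← sub_eq_of_eq_add' hwx, add_sub_add_left_eq_sub]
  obtain ⟨x, hx⟩ := hmem
  have h1 : u k - o ∈ range ι := ⟨x, by rw [hx, add_sub_cancel_left]⟩
  rwa [hι] at h1

end IsSmoothBody

end Trajectory

/-! ### Translation to the standard symplectic space -/

section Euclidean

variable {n : ℕ} {K : Set (Space n)}

/-- The standard complex structure as a linear isometry. -/
def isometryJ (n : ℕ) : Space n →ₗᵢ[ℝ] Space n where
  toLinearMap := J n
  norm_map' v := by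
    rw [EuclideanSpace.norm_eq, EuclideanSpace.norm_eq]
    simp [J, Fintype.sum_sum_type, add_comm]

lemma isometryJ_apply (v : Space n) : isometryJ n v = J n v := rfl

lemma isometryJ_isometryJ (v : Space n) : isometryJ n (isometryJ n v) = -v := by
  ext i
  rcases i with i | i <;> simp [isometryJ_apply, J]

lemma isPlanar_of_sub_mem {S : Set (Space n)} {o : Space n} {V : Submodule ℝ (Space n)}
    (hV : Module.finrank ℝ V = 2) (h : ∀ x ∈ S, x - o ∈ V) : IsPlanar S :=
  ⟨AffineSubspace.mk' o V, by rwa [AffineSubspace.direction_mk'], fun x hx => h x hx⟩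

lemma IsPlanar.exists_submodule {S : Set (Space n)} (h : IsPlanar S) :
    ∃ V : Submodule ℝ (Space n), Module.finrank ℝ V = 2 ∧ ∀ x ∈ S, ∀ y ∈ S, x - y ∈ V :=
  let ⟨L, hL, hSL⟩ := h
  ⟨L.direction, hL, fun _ hx _ hy => AffineSubspace.vsub_mem_direction (hSL hx) (hSL hy)⟩

lemma isOuterNormal_normal (hK : IsSmoothBody K) {z : Space n} (hz : z ∈ frontier K) :
    IsOuterNormal K z (normal K z) :=
  ⟨hK.normal_ne_zero hz, fun _ hx => hK.inner_normal_le hz hx⟩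

lemma characteristicLine_eq (hK : IsSmoothBody K) {z : Space n} (hz : z ∈ frontier K) :
    characteristicLine K z = Submodule.span ℝ {isometryJ n (normal K z)} := by
  rw [characteristicLine, normalLine, Submodule.map_span]
  refine le_antisymm (Submodule.span_le.2 ?_) (Submodule.span_mono ?_)
  · rintro _ ⟨ν, hν, rfl⟩
    rw [hK.eq_smul_normal hz hν.1 hν.2, map_smul]
    exact Submodule.smul_mem _ _ (Submodule.mem_span_singleton_self _)
  · rw [singleton_subset_iff]
    exact ⟨_, isOuterNormal_normal hK hz, rfl⟩

lemma outerBilliardStep_iff (hK : IsSmoothBody K) {x y : Space n} :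
    OuterBilliardStep K x y ↔ IsTangentStep (isometryJ n) K x y := by
  constructor
  · rintro ⟨hx, hm, ν, hν, hxy⟩
    have h1 : y - x = ‖ν‖ • isometryJ n (normal K (midpoint ℝ x y)) := by
      rw [hxy, ← isometryJ_apply, ← map_smul, ← hK.eq_smul_normal hm hν.1 hν.2]
    have h2 : (‖ν‖ / 2) • isometryJ n (normal K (midpoint ℝ x y)) = (1 / 2 : ℝ) • (y - x) := by
      rw [h1]; module
    refine ⟨hx, _, hm, ‖ν‖ / 2, half_pos (norm_pos_iff.2 hν.1), ?_, ?_⟩ <;>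
    · rw [h2, midpoint_eq_smul_add, invOf_eq_inv]
      module
  · rintro ⟨hx, z, hz, s, hs, hzx, hy⟩
    have hm : midpoint ℝ x y = z := by
      rw [hy, midpoint_eq_smul_add, invOf_eq_inv]
      have : x = z - s • isometryJ n (normal K z) := eq_sub_of_add_eq hzx.symm
      nth_rw 1 [this]
      module
    refine ⟨hx, hm ▸ hz, (2 * s) • normal K z, ⟨?_, fun w hw => ?_⟩, ?_⟩
    · exact smul_ne_zero (by positivity) (hK.normal_ne_zero hz)
    · rw [hm, inner_smul_left]
      exact mul_nonpos_of_nonneg_of_nonpos (by simpa using hs.le) (hK.inner_normal_le hz hw)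
    · rw [← isometryJ_apply, map_smul, hy, sub_eq_iff_eq_add]
      nth_rw 1 [hzx]
      module

lemma IsFlowLine.isCharacteristic (hK : IsSmoothBody K) {γ : ℝ → Space n}
    (hγ : IsFlowLine (isometryJ n) K γ) : IsCharacteristic K γ := by
  refine ⟨by exact_mod_cast hK.contDiff_of_isFlowLine hγ 1, fun t => ⟨hγ.mem t, ?_, ?_⟩⟩
  · rw [hγ.deriv, Ne, map_eq_zero_iff _ (isometryJ n).injective]
    exact hK.normal_ne_zero (hγ.mem t)
  · rw [hγ.deriv, characteristicLine_eq hK (hγ.mem t)]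
    exact Submodule.mem_span_singleton_self _

end Euclidean

end OuterBilliard

theorem lemma4p1 (n : ℕ) (K : ConvexBody (OuterBilliard.Space n))
    (hint : (interior (K : Set (OuterBilliard.Space n))).Nonempty)
    (hstrict : StrictConvex ℝ (K : Set (OuterBilliard.Space n)))
    (hsmooth : OuterBilliard.HasSmoothBoundary (K : Set (OuterBilliard.Space n))) :
    (∀ u : ℕ → OuterBilliard.Space n,
        OuterBilliard.IsOuterBilliardTrajectory (K : Set (OuterBilliard.Space n)) u →
          OuterBilliard.IsPlanar (Set.range u)) ↔
      (∀ γ : ℝ → OuterBilliard.Space n,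
        OuterBilliard.IsCharacteristic (K : Set (OuterBilliard.Space n)) γ →
          OuterBilliard.IsPlanar (Set.range γ)) := by
  have hK : OuterBilliard.IsSmoothBody (K : Set (OuterBilliard.Space n)) :=
    ⟨K.isCompact, hstrict, hint, hsmooth⟩
  have hj := OuterBilliard.isometryJ_isometryJ (n := n)
  constructor
  · intro h Γ hΓ
    have hpl := hK.hasPlanarChains hj fun u hu => by
      obtain ⟨V, hV, hmem⟩ :=
        (h u fun k => (OuterBilliard.outerBilliardStep_iff hK).2 (hu k)).exists_submodule
      exact ⟨V, hV, fun k => hmem _ (mem_range_self _) _ (mem_range_self _)⟩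
    -- The given characteristic is only `C¹` and of arbitrary speed; the derivative arguments apply
    -- to the flow line containing it.
    obtain ⟨γ, hγ, hsub⟩ := hK.exists_range_subset_flowLine hj hΓ.1 (fun t => (hΓ.2 t).1)
      fun t => OuterBilliard.characteristicLine_eq hK (hΓ.2 t).1 ▸ (hΓ.2 t).2.2
    obtain ⟨o, S, hS, hmem⟩ := hK.exists_plane_of_isFlowLine hj hpl hγ
    refine OuterBilliard.isPlanar_of_sub_mem (o := o) hS fun x hx => ?_
    obtain ⟨t, rfl⟩ := hsub hx
    exact hmem t
  · intro h u hu
    obtain ⟨o, S, hS, hmem⟩ := hK.exists_plane_of_trajectory hj (fun γ hγ => by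
      obtain ⟨V, hV, hmem⟩ := (h γ (hγ.isCharacteristic hK)).exists_submodule
      exact ⟨γ 0, V, hV, fun t => hmem _ (mem_range_self _) _ (mem_range_self _)⟩)
      fun k => (OuterBilliard.outerBilliardStep_iff hK).1 (hu k)
    refine OuterBilliard.isPlanar_of_sub_mem (o := o) hS ?_
    rintro _ ⟨k, rfl⟩
    exact hmem k
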